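/- Call a finite simple graph $G$ irreducible if it is $K_4$-free, contains no four vertices inducing a diamond ($K_4$ minus one edge), and has no two distinct vertices $u,v$ with $N(u)\subseteq N(v)$. There is a single deterministic algorithm that, given any irreducible graph $G$ with $n$ vertices and diameter exactly $2$ (as an adjacency matrix), decides in time $2^{O(\sqrt{n\log n})}$ whether $G$ has a proper $3$-coloring, and outputs such a coloring if one exists. Here time is the number of steps of a unit-cost random access machine whose arithmetic consists of addition and truncated subtraction of natural numbers. -/

import Mathlib

open Filter Asymptotics

/-! ### The two reduction rules and irreducible graphs -/

/-- The diamond elimination rule applies: four vertices induce a diamond, that is, all pairs among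
them are adjacent except for one pair `u₁`, `u₂`. -/
def DiamondRuleApplies {V : Type*} (G : SimpleGraph V) : Prop :=
  ∃ u₁ u₂ u₃ u₄ : V, u₁ ≠ u₂ ∧ ¬ G.Adj u₁ u₂ ∧ G.Adj u₁ u₃ ∧ G.Adj u₁ u₄ ∧
    G.Adj u₂ u₃ ∧ G.Adj u₂ u₄ ∧ G.Adj u₃ u₄

/-- The siblings elimination rule applies: there are two distinct vertices `u`, `v` with
`N(u) ⊆ N(v)` (such vertices are never adjacent). -/
def SiblingsRuleApplies {V : Type*} (G : SimpleGraph V) : Prop :=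
  ∃ u v : V, u ≠ v ∧ G.neighborSet u ⊆ G.neighborSet v

/-- A `K₄`-free graph is irreducible if neither reduction rule can be applied to it. -/
structure IrreducibleGraph {V : Type*} (G : SimpleGraph V) : Prop where
  k4Free : G.CliqueFree 4
  noDiamond : ¬ DiamondRuleApplies G
  noSiblings : ¬ SiblingsRuleApplies G

/-! ### Random access machines with unit cost

Programs are written in structured form (sequences, conditionals and loops in place of jumps).
Registers and memory cells hold natural numbers. The only arithmetic is addition and truncated
subtraction, so that unit cost is polynomially equivalent to Turing machine time. -/

namespace RAM

/-- RAM programs. Registers are named by constants; the memory is accessed indirectly, through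
addresses held in registers. A program mentions finitely many registers. -/
inductive Prog : Type
  /-- Do nothing. -/
  | skip : Prog
  /-- `set i c`: `rᵢ := c`. -/
  | set (i c : ℕ) : Prog
  /-- `add i j k`: `rᵢ := rⱼ + rₖ`. -/
  | add (i j k : ℕ) : Prog
  /-- `sub i j k`: `rᵢ := max (rⱼ - rₖ) 0`. -/
  | sub (i j k : ℕ) : Prog
  /-- `load i j`: `rᵢ := mem[rⱼ]`. -/
  | load (i j : ℕ) : Prog
  /-- `store i j`: `mem[rᵢ] := rⱼ`. -/
  | store (i j : ℕ) : Prog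
  /-- `seq p q`: run `p`, then `q`. -/
  | seq (p q : Prog) : Prog
  /-- `ifPos i p q`: if `rᵢ > 0` run `p`, otherwise run `q`. -/
  | ifPos (i : ℕ) (p q : Prog) : Prog
  /-- `whilePos i p`: as long as `rᵢ > 0`, run `p`. -/
  | whilePos (i : ℕ) (p : Prog) : Prog

/-- The contents of the registers and of the memory. -/
structure State where
  reg : ℕ → ℕ
  mem : ℕ → ℕ

/-- The state after writing `x` to register `i`. -/
def State.setReg (s : State) (i x : ℕ) : State := ⟨Function.update s.reg i x, s.mem⟩

/-- The state after writing `x` to memory cell `a`. -/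
def State.setMem (s : State) (a x : ℕ) : State := ⟨s.reg, Function.update s.mem a x⟩

/-- `Exec p s s' t`: started in the state `s`, the program `p` halts in the state `s'` after
exactly `t` steps. Each instruction and each test of a conditional or of a loop is one step. -/
inductive Exec : Prog → State → State → ℕ → Prop
  | skip (s : State) : Exec Prog.skip s s 1
  | set (i c : ℕ) (s : State) : Exec (Prog.set i c) s (s.setReg i c) 1
  | add (i j k : ℕ) (s : State) : Exec (Prog.add i j k) s (s.setReg i (s.reg j + s.reg k)) 1
  | sub (i j k : ℕ) (s : State) : Exec (Prog.sub i j k) s (s.setReg i (s.reg j - s.reg k)) 1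
  | load (i j : ℕ) (s : State) : Exec (Prog.load i j) s (s.setReg i (s.mem (s.reg j))) 1
  | store (i j : ℕ) (s : State) : Exec (Prog.store i j) s (s.setMem (s.reg i) (s.reg j)) 1
  | seq {p q : Prog} {s s' s'' : State} {t t' : ℕ} :
      Exec p s s' t → Exec q s' s'' t' → Exec (Prog.seq p q) s s'' (t + t')
  | ifTrue {i : ℕ} {p q : Prog} {s s' : State} {t : ℕ} :
      0 < s.reg i → Exec p s s' t → Exec (Prog.ifPos i p q) s s' (t + 1)
  | ifFalse {i : ℕ} {p q : Prog} {s s' : State} {t : ℕ} :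
      s.reg i = 0 → Exec q s s' t → Exec (Prog.ifPos i p q) s s' (t + 1)
  | whileTrue {i : ℕ} {p : Prog} {s s' s'' : State} {t t' : ℕ} :
      0 < s.reg i → Exec p s s' t → Exec (Prog.whilePos i p) s' s'' t' →
      Exec (Prog.whilePos i p) s s'' (t + t' + 1)
  | whileFalse {i : ℕ} {p : Prog} {s : State} :
      s.reg i = 0 → Exec (Prog.whilePos i p) s s 1

open Classical in
/-- The initial state on the input graph `G` with vertices `0, …, n - 1`: register `0` holds `n`,
the memory cells `0, …, n² - 1` hold the adjacency matrix of `G` row by row, and everything else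
is `0`. -/
noncomputable def input {n : ℕ} (G : SimpleGraph (Fin n)) : State where
  reg := fun i => if i = 0 then n else 0
  mem := fun a => if ∃ u v : Fin n, a = n * u + v ∧ G.Adj u v then 1 else 0

/-- The state `s` holds a correct answer to the `3`-coloring problem on `G`: register `0` holds `1`
or `0` according to whether `G` is `3`-colorable, and if it is, then the memory cells
`0, …, n - 1` hold the colors from `{0, 1, 2}` of the vertices in some proper `3`-coloring. -/
def AnswersThreeColoring {n : ℕ} (G : SimpleGraph (Fin n)) (s : State) : Prop :=
  (G.Colorable 3 → s.reg 0 = 1 ∧ ∃ c : G.Coloring (Fin 3), ∀ v : Fin n, s.mem v = c v) ∧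
    (¬ G.Colorable 3 → s.reg 0 = 0)

end RAM

/-! In a graph of diameter two the neighborhood of every vertex dominates all vertices, so some
dominating set is no larger than the minimum degree δ. When δ is large, the greedy algorithm does
better: by double counting (`mul_count_le`) some vertex is adjacent to at least a fraction δ/n of
the vertices that have no neighbor in the set yet. After k rounds at most n(1 - δ/n)^k such vertices
are left, each later round removes at least one of them, and the final set has at most k + n(1 -
δ/n)^k elements (`greedyCmd_spec`). The set that is used obeys both bounds; if δ exceeds √(n log n),
the choice of k near n ln n / δ shows that its size m is at most √(n log₂ n) + 2
(`le_sqrt_of_forall_le`).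

All 3^m colorings of this set are enumerated. Once the set is colored, every other vertex has a
colored neighbor and at most two possible colors, so what remains is an instance of 2-SAT. It is
solved by limited backtracking: color a vertex tentatively, propagate forced colors, and undo this
only if some edge gets two equal ends. A state without such an edge and without further forced
colors can be kept for good, because its colors can overwrite those of any proper coloring that
extends the earlier state (`exists_isCol_of_closed`). Hence each of the 3^m rounds takes time
polynomial in n + 3^m, and so does the whole algorithm.

To count machine steps, the algorithm is written in a small language with bounded loops. Its
compiler is verified once (`Cmd.compile_spec`), and each command has a running time polynomial in
the two loop bounds n and M (`Cmd.time_le`), where M becomes 3^m for the enumeration. -/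

namespace RAM

/-! ### A small language with arrays and bounded loops -/

/-- Arithmetic expressions over scalar variables, eight arrays and the input array. -/
inductive Expr : Type
  | const (c : ℕ)
  | var (x : ℕ)
  | size
  | add (a b : Expr)
  | sub (a b : Expr)
  | get (a : Fin 8) (i : Expr)
  | inp (i : Expr)

/-- Commands. The loop `loop m x c` runs `c` for `x = 0, 1, …`, with the number of rounds being
`M` if `m` is true and `n` otherwise. -/
inductive Cmd : Type
  | assign (x : ℕ) (e : Expr)
  | put (a : Fin 8) (i e : Expr)
  | out (i e : Expr)
  | seq (c d : Cmd)
  | ite (e : Expr) (c d : Cmd)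
  | skip
  | loop (m : Bool) (x : ℕ) (c : Cmd)

/-- Environments: two loop bounds `n` and `M`, the length `b` of the input array, the scalar
variables, the arrays and the input array. -/
structure Env where
  n : ℕ
  M : ℕ
  b : ℕ
  v : ℕ → ℕ
  arr : Fin 8 → ℕ → ℕ
  inp : ℕ → ℕ

namespace Env

/-- Assign to a scalar variable. -/
def setV (e : Env) (x a : ℕ) : Env := { e with v := Function.update e.v x a }

/-- Assign to an array cell. -/
def setA (e : Env) (a : Fin 8) (i y : ℕ) : Env :=
  { e with arr := Function.update e.arr a (Function.update (e.arr a) i y) }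

/-- Assign to a cell of the input array. -/
def setI (e : Env) (i y : ℕ) : Env :=
  { e with inp := if i < e.b then Function.update e.inp i y else e.inp }

/-- The number of rounds of a loop. -/
def bound (e : Env) (m : Bool) : ℕ := if m then e.M else e.n

end Env

/-- The value of an expression. -/
def Expr.eval (e : Env) : Expr → ℕ
  | const c => c
  | var x => e.v x
  | size => e.n
  | add a b => a.eval e + b.eval e
  | sub a b => a.eval e - b.eval e
  | get a i => e.arr a (i.eval e)
  | inp i => e.inp (i.eval e)

/-- Bounded iteration. -/
def iter (f : ℕ → Env → Env) : ℕ → Env → Env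
  | 0, a => a
  | k + 1, a => f k (iter f k a)

/-- The effect of a command. -/
def Cmd.eval : Cmd → Env → Env
  | assign x a, e => e.setV x (a.eval e)
  | put a i y, e => e.setA a (i.eval e) (y.eval e)
  | out i y, e => e.setI (i.eval e) (y.eval e)
  | seq c d, e => d.eval (c.eval e)
  | ite a c d, e => if 0 < a.eval e then c.eval e else d.eval e
  | skip, e => e
  | loop m x c, e => iter (fun i e => c.eval (e.setV x i)) (e.bound m) e

theorem iter_induction {f : ℕ → Env → Env} {k : ℕ} {a : Env} (I : ℕ → Env → Prop)
    (h0 : I 0 a) (hs : ∀ i < k, ∀ a, I i a → I (i + 1) (f i a)) : I k (iter f k a) := by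
  induction k with
  | zero => exact h0
  | succ k ih => exact hs k (by omega) _ (ih fun i hi => hs i (by omega))

/-- The variables a command may change. -/
def Cmd.vars : Cmd → List ℕ
  | assign x _ => [x]
  | put _ _ _ => []
  | out _ _ => []
  | seq c d => c.vars ++ d.vars
  | ite _ c d => c.vars ++ d.vars
  | skip => []
  | loop _ x c => x :: c.vars

/-- The arrays a command may change. -/
def Cmd.arrs : Cmd → List (Fin 8)
  | assign _ _ => []
  | put a _ _ => [a]
  | out _ _ => []
  | seq c d => c.arrs ++ d.arrs
  | ite _ c d => c.arrs ++ d.arrs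
  | skip => []
  | loop _ _ c => c.arrs

/-- Whether a command may change the input array. -/
def Cmd.outs : Cmd → Bool
  | assign _ _ => false
  | put _ _ _ => false
  | out _ _ => true
  | seq c d => c.outs || d.outs
  | ite _ c d => c.outs || d.outs
  | skip => false
  | loop _ _ c => c.outs

namespace Cmd

theorem eval_bounds (c : Cmd) (e : Env) :
    (c.eval e).n = e.n ∧ (c.eval e).M = e.M ∧ (c.eval e).b = e.b := by
  induction c generalizing e with
  | assign => simp [eval, Env.setV]
  | put => simp [eval, Env.setA]
  | out => simp [eval, Env.setI]
  | seq c d hc hd => simp [eval, hc, hd]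
  | ite a c d hc hd => simp only [eval]; split_ifs <;> simp [hc, hd]
  | skip => simp [eval]
  | loop m x c hc =>
    exact iter_induction (fun _ a => a.n = e.n ∧ a.M = e.M ∧ a.b = e.b) ⟨rfl, rfl, rfl⟩
      fun i _ a ha => by simpa [hc, Env.setV] using ha

@[simp] theorem eval_n (c : Cmd) (e : Env) : (c.eval e).n = e.n := (c.eval_bounds e).1
@[simp] theorem eval_M (c : Cmd) (e : Env) : (c.eval e).M = e.M := (c.eval_bounds e).2.1
@[simp] theorem eval_b (c : Cmd) (e : Env) : (c.eval e).b = e.b := (c.eval_bounds e).2.2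

theorem eval_v (c : Cmd) (e : Env) {x : ℕ} (hx : x ∉ c.vars) : (c.eval e).v x = e.v x := by
  induction c generalizing e with
  | assign y a =>
    simp only [vars, List.mem_singleton] at hx
    simp [eval, Env.setV, Function.update_of_ne hx]
  | put => simp [eval, Env.setA]
  | out => simp [eval, Env.setI]
  | seq c d hc hd =>
    simp only [vars, List.mem_append, not_or] at hx
    simp [eval, hc _ hx.1, hd _ hx.2]
  | ite a c d hc hd =>
    simp only [vars, List.mem_append, not_or] at hx
    simp only [eval]; split_ifs <;> simp [hc _ hx.1, hd _ hx.2]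
  | skip => simp [eval]
  | loop m y c hc =>
    simp only [vars, List.mem_cons, not_or] at hx
    exact iter_induction (fun _ a => a.v x = e.v x) rfl
      fun i _ a ha => by simpa [hc _ hx.2, Env.setV, Function.update_of_ne hx.1] using ha

theorem eval_arr (c : Cmd) (e : Env) {a : Fin 8} (ha : a ∉ c.arrs) :
    (c.eval e).arr a = e.arr a := by
  induction c generalizing e with
  | assign y a => simp [eval, Env.setV]
  | put =>
    simp only [arrs, List.mem_singleton] at ha
    simp [eval, Env.setA, Function.update_of_ne ha]
  | out => simp [eval, Env.setI]
  | seq c d hc hd =>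
    simp only [arrs, List.mem_append, not_or] at ha
    simp [eval, hc _ ha.1, hd _ ha.2]
  | ite y c d hc hd =>
    simp only [arrs, List.mem_append, not_or] at ha
    simp only [eval]; split_ifs <;> simp [hc _ ha.1, hd _ ha.2]
  | skip => simp [eval]
  | loop m y c hc =>
    exact iter_induction (fun _ z => z.arr a = e.arr a) rfl
      fun i _ z hz => by simpa [hc _ ha, Env.setV] using hz

theorem eval_inp (c : Cmd) (e : Env) (hc : c.outs = false) : (c.eval e).inp = e.inp := by
  induction c generalizing e with
  | assign y a => simp [eval, Env.setV]
  | put => simp [eval, Env.setA]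
  | out => simp [outs] at hc
  | seq c d ihc ihd =>
    simp only [outs, Bool.or_eq_false_iff] at hc
    simp [eval, ihc _ hc.1, ihd _ hc.2]
  | ite y c d ihc ihd =>
    simp only [outs, Bool.or_eq_false_iff] at hc
    simp only [eval]; split_ifs <;> simp [ihc _ hc.1, ihd _ hc.2]
  | skip => simp [eval]
  | loop m y c ihc =>
    exact iter_induction (fun _ z => z.inp = e.inp) rfl
      fun i _ z hz => by simpa [ihc _ hc, Env.setV] using hz

end Cmd

/-! ### Compilation -/

/-- The register of a variable. -/
abbrev vreg (x : ℕ) : ℕ := 2 * x + 3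

/-- The register of a temporary value. -/
abbrev treg (d : ℕ) : ℕ := 2 * d + 4

/-- The environment represented by a machine state. -/
def decode (s : State) : Env where
  n := s.reg 0
  M := s.reg 2
  b := s.reg 1
  v x := s.reg (vreg x)
  -- The eight arrays are interleaved above the base address in register 1, so each of them is
  -- unbounded and no two share a cell.
  arr a i := s.mem (s.reg 1 + 8 * i + a)
  -- Cutting off at the base address keeps the input array disjoint from the others, so a write to
  -- one does not show in the other.
  inp i := if i < s.reg 1 then s.mem i else 0

/-- Replace the index in the temporary register `d` by the address of the cell of array `a`. -/
def addrProg (a : Fin 8) (d : ℕ) : Prog :=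
  .seq (.add (treg d) (treg d) (treg d)) <| .seq (.add (treg d) (treg d) (treg d)) <|
  .seq (.add (treg d) (treg d) (treg d)) <| .seq (.set (treg (d + 1)) a) <|
  .seq (.add (treg d) (treg d) (treg (d + 1))) (.add (treg d) (treg d) 1)

/-- Copy a register. -/
def copyProg (i j : ℕ) : Prog := .seq (.set i 0) (.add i i j)

/-- Code for an expression, with the value left in the temporary register `d`. -/
def Expr.compile : Expr → ℕ → Prog
  | const c, d => .set (treg d) c
  | var x, d => copyProg (treg d) (vreg x)
  | size, d => copyProg (treg d) 0
  | add a b, d => .seq (a.compile d) (.seq (b.compile (d + 1))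
      (.add (treg d) (treg d) (treg (d + 1))))
  | sub a b, d => .seq (a.compile d) (.seq (b.compile (d + 1))
      (.sub (treg d) (treg d) (treg (d + 1))))
  | get a i, d => .seq (i.compile d) (.seq (addrProg a d) (.load (treg d) (treg d)))
  | inp i, d => .seq (i.compile d) (.seq (.sub (treg (d + 1)) 1 (treg d))
      (.ifPos (treg (d + 1)) (.load (treg d) (treg d)) (.set (treg d) 0)))

/-- Code for a command that uses only temporary registers from `d` on. -/
def Cmd.compile : Cmd → ℕ → Prog
  | assign x a, d => .seq (a.compile d) (copyProg (vreg x) (treg d))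
  | put a i y, d => .seq (y.compile d) (.seq (i.compile (d + 1)) (.seq (addrProg a (d + 1))
      (.store (treg (d + 1)) (treg d))))
  | out i y, d => .seq (y.compile d) (.seq (i.compile (d + 1))
      (.seq (.sub (treg (d + 2)) 1 (treg (d + 1)))
        (.ifPos (treg (d + 2)) (.store (treg (d + 1)) (treg d)) .skip)))
  | seq p q, d => .seq (p.compile d) (q.compile d)
  | ite a p q, d => .seq (a.compile d) (.ifPos (treg d) (p.compile d) (q.compile d))
  | skip, _ => .skip
  -- Temporary `d` counts the rounds to go and `d + 1` the rounds done; `d + 2` provides the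
  -- constant 1, and the body may use only what lies above.
  | loop m x p, d => .seq (copyProg (treg d) (if m then 2 else 0)) <|
      .seq (.set (treg (d + 1)) 0) <| .whilePos (treg d) <|
        .seq (copyProg (vreg x) (treg (d + 1))) <| .seq (p.compile (d + 3)) <|
        .seq (.set (treg (d + 2)) 1) <| .seq (.sub (treg d) (treg d) (treg (d + 2)))
          (.add (treg (d + 1)) (treg (d + 1)) (treg (d + 2)))

/-- The program `p` leads from `s` to `s'` in at most `k` steps. -/
def Within (p : Prog) (s s' : State) (k : ℕ) : Prop := ∃ t ≤ k, Exec p s s' t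

namespace Within

variable {p q : Prog} {s s' s'' : State} {k l i : ℕ}

theorem of_exec (h : Exec p s s' k) : Within p s s' k := ⟨k, le_rfl, h⟩

theorem mono (h : Within p s s' k) (hk : k ≤ l) : Within p s s' l := by
  obtain ⟨t, ht, h⟩ := h
  exact ⟨t, ht.trans hk, h⟩

theorem seq (h : Within p s s' k) (h' : Within q s' s'' l) :
    Within (.seq p q) s s'' (k + l) := by
  obtain ⟨t, ht, h⟩ := h
  obtain ⟨t', ht', h'⟩ := h'
  exact ⟨t + t', by omega, .seq h h'⟩

theorem ifTrue (hi : 0 < s.reg i) (h : Within p s s' k) : Within (.ifPos i p q) s s' (k + 1) := by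
  obtain ⟨t, ht, h⟩ := h
  exact ⟨t + 1, by omega, .ifTrue hi h⟩

theorem ifFalse (hi : s.reg i = 0) (h : Within q s s' k) :
    Within (.ifPos i p q) s s' (k + 1) := by
  obtain ⟨t, ht, h⟩ := h
  exact ⟨t + 1, by omega, .ifFalse hi h⟩

theorem whileTrue (hi : 0 < s.reg i) (h : Within p s s' k)
    (h' : Within (.whilePos i p) s' s'' l) : Within (.whilePos i p) s s'' (k + l + 1) := by
  obtain ⟨t, ht, h⟩ := h
  obtain ⟨t', ht', h'⟩ := h'
  exact ⟨t + t' + 1, by omega, .whileTrue hi h h'⟩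

end Within

theorem within_copy {i j : ℕ} (hij : j ≠ i) (s : State) :
    Within (copyProg i j) s (s.setReg i (s.reg j)) 2 := by
  have h := (Within.of_exec (Exec.set i 0 s)).seq (.of_exec (Exec.add i i j (s.setReg i 0)))
  have e : s.setReg i (s.reg j) =
      (s.setReg i 0).setReg i ((s.setReg i 0).reg i + (s.setReg i 0).reg j) := by
    simp [State.setReg, Function.update_of_ne hij]
  rw [e]
  exact h

theorem within_addr (a : Fin 8) (d : ℕ) (s : State) :
    Within (addrProg a d) s
      ((s.setReg (treg (d + 1)) a).setReg (treg d) (s.reg 1 + 8 * s.reg (treg d) + a)) 6 := by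
  have h := (Within.of_exec (Exec.add (treg d) (treg d) (treg d) s)).seq
    ((Within.of_exec (Exec.add (treg d) (treg d) (treg d) _)).seq
    ((Within.of_exec (Exec.add (treg d) (treg d) (treg d) _)).seq
    ((Within.of_exec (Exec.set (treg (d + 1)) a _)).seq
    ((Within.of_exec (Exec.add (treg d) (treg d) (treg (d + 1)) _)).seq
    (Within.of_exec (Exec.add (treg d) (treg d) 1 _))))))
  refine (congrArg (Within _ s · 6) ?_).mp h
  simp only [State.setReg, State.mk.injEq, and_true]
  have h1 : treg d ≠ treg (d + 1) := by simp
  have h2 : 1 ≠ treg d := by simp only [treg]; omega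
  have h3 : 1 ≠ treg (d + 1) := by simp only [treg]; omega
  funext r
  simp only [Function.update_apply, h1, h1.symm, h2, h3, if_true, if_false]
  split_ifs <;> omega

/-- The states agree on the memory and on all registers except for the temporary ones from
`d` on. -/
def Agree (d : ℕ) (s s' : State) : Prop :=
  s'.mem = s.mem ∧ ∀ r, (∀ j, d ≤ j → r ≠ treg j) → s'.reg r = s.reg r

namespace Agree

variable {d d' : ℕ} {s s' s'' : State}

theorem trans (h : Agree d s s') (h' : Agree d' s' s'') (hd : d ≤ d') : Agree d s s'' :=
  ⟨h'.1.trans h.1, fun r hr => (h'.2 r fun j hj => hr j (hd.trans hj)).trans (h.2 r hr)⟩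

theorem setReg (s : State) {j : ℕ} (hj : d ≤ j) (a : ℕ) : Agree d s (s.setReg (treg j) a) :=
  ⟨rfl, fun r hr => by simp [State.setReg, Function.update_of_ne (hr j hj)]⟩

theorem reg_lt (h : Agree d s s') {j : ℕ} (hj : j < d) : s'.reg (treg j) = s.reg (treg j) :=
  h.2 _ fun i hi => by simp only [treg]; omega

theorem reg_one (h : Agree d s s') : s'.reg 1 = s.reg 1 :=
  h.2 _ fun i hi => by simp only [treg]; omega

theorem decode_eq (h : Agree d s s') : decode s' = decode s := by
  have h0 : s'.reg 0 = s.reg 0 := h.2 _ fun i hi => by simp only [treg]; omega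
  have h1 := h.reg_one
  have h2 : s'.reg 2 = s.reg 2 := h.2 _ fun i hi => by simp only [treg]; omega
  have hv : ∀ x, s'.reg (vreg x) = s.reg (vreg x) := fun x =>
    h.2 _ fun i hi => by simp only [treg, vreg]; omega
  simp only [decode, h0, h1, h2, hv, h.1]

end Agree

/-! ### Correctness and running time of the compiled code. -/

/-- A bound for the running time of the code for an expression. -/
def Expr.time : Expr → ℕ
  | const _ => 1
  | var _ => 2
  | size => 2
  | add a b => a.time + (b.time + 1)
  | sub a b => a.time + (b.time + 1)
  | get _ i => i.time + (6 + 1)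
  | inp i => i.time + (1 + (1 + 1))

@[simp] theorem reg_setReg_self (s : State) (i a : ℕ) : (s.setReg i a).reg i = a := by
  simp [State.setReg]

/-- The temporaries serve as a stack: the value of the first operand in `d` survives the evaluation
of the second one, which starts at `d + 1`. -/
theorem Expr.compile_spec (a : Expr) (d : ℕ) (s : State) :
    ∃ s', Within (a.compile d) s s' a.time ∧ Agree d s s' ∧
      s'.reg (treg d) = a.eval (decode s) := by
  induction a generalizing d s with
  | const c => exact ⟨_, .of_exec (.set _ _ _), .setReg s le_rfl _, by simp [eval]⟩
  | var x =>
    exact ⟨_, within_copy (by simp only [treg, vreg]; omega) s, .setReg s le_rfl _,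
      by simp [eval, decode]⟩
  | size =>
    exact ⟨_, within_copy (by simp only [treg]; omega) s, .setReg s le_rfl _,
      by simp [eval, decode]⟩
  | add a b iha ihb =>
    obtain ⟨s₁, h₁, g₁, e₁⟩ := iha d s
    obtain ⟨s₂, h₂, g₂, e₂⟩ := ihb (d + 1) s₁
    refine ⟨_, h₁.seq (h₂.seq (.of_exec (.add _ _ _ _))),
      (g₁.trans g₂ (by omega)).trans (.setReg _ le_rfl _) le_rfl, ?_⟩
    rw [reg_setReg_self, e₂, g₂.reg_lt (by omega), e₁, g₁.decode_eq, eval]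
  | sub a b iha ihb =>
    obtain ⟨s₁, h₁, g₁, e₁⟩ := iha d s
    obtain ⟨s₂, h₂, g₂, e₂⟩ := ihb (d + 1) s₁
    refine ⟨_, h₁.seq (h₂.seq (.of_exec (.sub _ _ _ _))),
      (g₁.trans g₂ (by omega)).trans (.setReg _ le_rfl _) le_rfl, ?_⟩
    rw [reg_setReg_self, e₂, g₂.reg_lt (by omega), e₁, g₁.decode_eq, eval]
  | get a i ih =>
    obtain ⟨s₁, h₁, g₁, e₁⟩ := ih d s
    refine ⟨_, h₁.seq ((within_addr a d s₁).seq (.of_exec (.load _ _ _))),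
      (((g₁.trans (.setReg _ (Nat.le_succ d) _) le_rfl).trans (.setReg _ le_rfl _) le_rfl)).trans
      (.setReg _ le_rfl _) le_rfl, ?_⟩
    rw [reg_setReg_self, reg_setReg_self, e₁, g₁.reg_one, eval]
    simp only [State.setReg, g₁.1]
    rfl
  | inp i ih =>
    obtain ⟨s₁, h₁, g₁, e₁⟩ := ih d s
    have hne : treg d ≠ treg (d + 1) := by simp
    by_cases h : i.eval (decode s) < s.reg 1
    · refine ⟨_, h₁.seq ((Within.of_exec (.sub _ _ _ _)).seq
        (.ifTrue ?_ (.of_exec (.load _ _ _)))),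
        (g₁.trans (.setReg _ (Nat.le_succ d) _) le_rfl).trans (.setReg _ le_rfl _) le_rfl, ?_⟩
      · rw [reg_setReg_self, e₁, g₁.reg_one]; omega
      · simp [State.setReg, e₁, g₁.1, eval, decode] at h ⊢
        simp [h]
    · refine ⟨_, h₁.seq ((Within.of_exec (.sub _ _ _ _)).seq
        (.ifFalse ?_ (.of_exec (.set _ _ _)))),
        (g₁.trans (.setReg _ (Nat.le_succ d) _) le_rfl).trans (.setReg _ le_rfl _) le_rfl, ?_⟩
      · rw [reg_setReg_self, e₁, g₁.reg_one]; omega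
      · simp [eval, decode] at h ⊢
        omega

/-- A bound for the running time of the code for a command. -/
def Cmd.time (n M : ℕ) : Cmd → ℕ
  | assign _ a => a.time + 2
  | put _ i y => y.time + (i.time + (6 + 1))
  | out i y => y.time + (i.time + (1 + (1 + 1)))
  | seq c d => c.time n M + d.time n M
  | ite a c d => a.time + (c.time n M + d.time n M + 1)
  | skip => 1
  | loop _ _ c => 2 + (1 + ((n + M) * (c.time n M + 6) + 1))

/-- The states agree on all temporary registers below `d`. -/
def Keep (d : ℕ) (s s' : State) : Prop := ∀ j < d, s'.reg (treg j) = s.reg (treg j)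

theorem Keep.trans {d d' : ℕ} {s s' s'' : State} (h : Keep d s s') (h' : Keep d' s' s'')
    (hd : d ≤ d') : Keep d s s'' :=
  fun j hj => (h' j (by omega)).trans (h j hj)

theorem Agree.keep {d d' : ℕ} {s s' : State} (h : Agree d s s') (hd : d' ≤ d) : Keep d' s s' :=
  fun _ hj => h.reg_lt (by omega)

theorem decode_setReg_vreg (s : State) (x a : ℕ) :
    decode (s.setReg (vreg x) a) = (decode s).setV x a := by
  have h0 : 0 ≠ vreg x := by simp only [vreg]; omega
  have h1 : 1 ≠ vreg x := by simp only [vreg]; omega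
  have h2 : 2 ≠ vreg x := by simp only [vreg]; omega
  simp only [decode, State.setReg, Env.setV, Function.update_of_ne h0, Function.update_of_ne h1,
    Function.update_of_ne h2, Env.mk.injEq, true_and, and_true]
  funext y
  simp only [Function.update_apply]
  congr 1
  simp

theorem keep_setReg_vreg (d : ℕ) (s : State) (x a : ℕ) : Keep d s (s.setReg (vreg x) a) :=
  fun j _ => by
    have : treg j ≠ vreg x := by simp only [treg, vreg]; omega
    simp [State.setReg, Function.update_of_ne this]

theorem decode_setMem_arr (s : State) (a : Fin 8) (i y : ℕ) :
    decode (s.setMem (s.reg 1 + 8 * i + a) y) = (decode s).setA a i y := by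
  simp only [decode, State.setMem, Env.setA, Env.mk.injEq, true_and]
  constructor
  · funext a' i'
    by_cases ha : a' = a
    · subst ha
      simp only [Function.update_apply, if_true]
      congr 1
      simp only [eq_iff_iff]; omega
    · have : s.reg 1 + 8 * i' + (a' : ℕ) ≠ s.reg 1 + 8 * i + (a : ℕ) := by
        intro h
        exact ha (Fin.ext (by omega))
      simp [Function.update_of_ne ha, Function.update_of_ne this]
  · funext j
    by_cases hj : j < s.reg 1
    · have : j ≠ s.reg 1 + 8 * i + (a : ℕ) := by omega
      simp [hj, Function.update_of_ne this]
    · simp [hj]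

theorem decode_setMem_inp (s : State) {i : ℕ} (hi : i < s.reg 1) (y : ℕ) :
    decode (s.setMem i y) = (decode s).setI i y := by
  simp only [decode, State.setMem, Env.setI, Env.mk.injEq, true_and, hi, if_true]
  constructor
  · funext a' i'
    have : s.reg 1 + 8 * i' + (a' : ℕ) ≠ i := by omega
    simp [Function.update_of_ne this]
  · funext j
    by_cases hj : j = i
    · subst hj; simp [hi]
    · simp [Function.update_of_ne hj]

theorem bound_le (e : Env) (m : Bool) : e.bound m ≤ e.n + e.M := by
  unfold Env.bound; split_ifs <;> omega

/-- Simulation of commands by machine code. Commands change variables and memory, so `Agree` is too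
strong; `Keep` retains what an enclosing loop or a pending evaluation needs, namely the temporaries
below `d`. -/
theorem Cmd.compile_spec (c : Cmd) (d : ℕ) (s : State) :
    ∃ s', Within (c.compile d) s s' (c.time (s.reg 0) (s.reg 2)) ∧ Keep d s s' ∧
      decode s' = c.eval (decode s) := by
  induction c generalizing d s with
  | assign x a =>
    obtain ⟨s₁, h₁, g₁, e₁⟩ := a.compile_spec d s
    refine ⟨_, h₁.seq (within_copy (by simp only [treg, vreg]; omega) _),
      (g₁.keep le_rfl).trans (keep_setReg_vreg d _ _ _) le_rfl, ?_⟩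
    rw [decode_setReg_vreg, g₁.decode_eq, e₁, eval]
  | put a i y =>
    obtain ⟨s₁, h₁, g₁, e₁⟩ := y.compile_spec d s
    obtain ⟨s₂, h₂, g₂, e₂⟩ := i.compile_spec (d + 1) s₁
    have g := (((g₁.trans g₂ (by omega)).trans (.setReg (j := d + 1 + 1) _ (by omega) a)
      le_rfl).trans (.setReg (j := d + 1) _ (by omega)
        (s₂.reg 1 + 8 * s₂.reg (treg (d + 1)) + a)) le_rfl)
    refine ⟨_, h₁.seq (h₂.seq ((within_addr a (d + 1) s₂).seq (.of_exec (.store _ _ _)))),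
      (g.keep le_rfl).trans (d' := d) (fun _ _ => rfl) le_rfl, ?_⟩
    rw [reg_setReg_self]
    have h3 : treg d ≠ treg (d + 1) := by simp
    have h4 : treg d ≠ treg (d + 1 + 1) := by simp; omega
    have h5 : ((s₂.setReg (treg (d + 1 + 1)) a).setReg (treg (d + 1))
        (s₂.reg 1 + 8 * s₂.reg (treg (d + 1)) + a)).reg (treg d) = y.eval (decode s) := by
      simp only [State.setReg, Function.update_of_ne h3, Function.update_of_ne h4]
      rw [g₂.reg_lt (by omega), e₁]
    have h7 : s₂.reg 1 = s.reg 1 := (g₁.trans g₂ (by omega)).reg_one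
    have key : ∀ w, Agree d s w → decode (w.setMem (s.reg 1 + 8 * i.eval (decode s) + a)
        (y.eval (decode s))) = (put a i y).eval (decode s) := fun w hw => by
      rw [← hw.reg_one, decode_setMem_arr, hw.decode_eq, eval]
    rw [h5]
    have h8 : s₂.reg 1 + 8 * s₂.reg (treg (d + 1)) + a = s.reg 1 + 8 * i.eval (decode s) + a := by
      rw [h7, e₂, g₁.decode_eq]
    rw [h8] at g ⊢
    exact key _ g
  | out i y =>
    obtain ⟨s₁, h₁, g₁, e₁⟩ := y.compile_spec d s
    obtain ⟨s₂, h₂, g₂, e₂⟩ := i.compile_spec (d + 1) s₁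
    have g := ((g₁.trans g₂ (by omega)).trans (.setReg (j := d + 2) _ (by omega)
      (s₂.reg 1 - s₂.reg (treg (d + 1)))) le_rfl)
    have h3 : treg d ≠ treg (d + 2) := by simp
    have h4 : treg (d + 1) ≠ treg (d + 2) := by simp
    have h7 : s₂.reg 1 = s.reg 1 := (g₁.trans g₂ (by omega)).reg_one
    have e₃ : s₂.reg (treg (d + 1)) = i.eval (decode s) := by rw [e₂, g₁.decode_eq]
    by_cases h : i.eval (decode s) < s.reg 1
    · refine ⟨_, h₁.seq (h₂.seq ((Within.of_exec (.sub _ _ _ _)).seq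
        (.ifTrue ?_ (.of_exec (.store _ _ _))))),
        (g.keep le_rfl).trans (d' := d) (fun _ _ => rfl) le_rfl, ?_⟩
      · rw [reg_setReg_self, e₃, h7]; omega
      · have h5 : (s₂.setReg (treg (d + 2)) (s₂.reg 1 - s₂.reg (treg (d + 1)))).reg (treg (d + 1))
            = i.eval (decode s) := by
          simp only [State.setReg, Function.update_of_ne h4]
          exact e₃
        have h6 : (s₂.setReg (treg (d + 2)) (s₂.reg 1 - s₂.reg (treg (d + 1)))).reg (treg d)
            = y.eval (decode s) := by
          simp only [State.setReg, Function.update_of_ne h3]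
          rw [g₂.reg_lt (by omega), e₁]
        rw [h5, h6, decode_setMem_inp _ (by rw [g.reg_one]; exact h), g.decode_eq, eval]
    · refine ⟨_, h₁.seq (h₂.seq ((Within.of_exec (.sub _ _ _ _)).seq
        (.ifFalse ?_ (.of_exec (.skip _))))), g.keep le_rfl, ?_⟩
      · rw [reg_setReg_self, e₃, h7]; omega
      · rw [g.decode_eq, eval, Env.setI, if_neg (by exact h)]
  | seq p q ihp ihq =>
    obtain ⟨s₁, h₁, g₁, e₁⟩ := ihp d s
    obtain ⟨s₂, h₂, g₂, e₂⟩ := ihq d s₁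
    have hn : s₁.reg 0 = s.reg 0 := by
      have := congrArg Env.n e₁; rwa [eval_n] at this
    have hM : s₁.reg 2 = s.reg 2 := by
      have := congrArg Env.M e₁; rwa [eval_M] at this
    rw [hn, hM] at h₂
    exact ⟨s₂, h₁.seq h₂, g₁.trans g₂ le_rfl, by rw [e₂, e₁, eval]⟩
  | ite a p q ihp ihq =>
    obtain ⟨s₁, h₁, g₁, e₁⟩ := a.compile_spec d s
    have hn : s₁.reg 0 = s.reg 0 := congrArg Env.n g₁.decode_eq
    have hM : s₁.reg 2 = s.reg 2 := congrArg Env.M g₁.decode_eq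
    by_cases h : 0 < a.eval (decode s)
    · obtain ⟨s₂, h₂, g₂, e₂⟩ := ihp d s₁
      rw [hn, hM] at h₂
      refine ⟨s₂, h₁.seq ((Within.ifTrue (by rw [e₁]; exact h) h₂).mono ?_),
        (g₁.keep le_rfl).trans g₂ le_rfl, ?_⟩
      · omega
      · rw [e₂, g₁.decode_eq, eval, if_pos h]
    · obtain ⟨s₂, h₂, g₂, e₂⟩ := ihq d s₁
      rw [hn, hM] at h₂
      refine ⟨s₂, h₁.seq ((Within.ifFalse (by rw [e₁]; omega) h₂).mono ?_),
        (g₁.keep le_rfl).trans g₂ le_rfl, ?_⟩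
      · omega
      · rw [e₂, g₁.decode_eq, eval, if_neg h]
  | skip => exact ⟨s, .of_exec (.skip s), fun _ _ => rfl, rfl⟩
  | loop m x p ih =>
    set n := s.reg 0 with hn
    set M := s.reg 2 with hM
    set k := (decode s).bound m with hk
    set f : ℕ → Env → Env := fun i e => p.eval (e.setV x i) with hf
    have hkn : k ≤ n + M := bound_le _ _
    -- the loop, started with `r` rounds to go
    have key : ∀ r i, r + i = k → ∀ u : State, u.reg (treg d) = r → u.reg (treg (d + 1)) = i →
        Keep d s u → decode u = iter f i (decode s) →
        ∃ s', Within (.whilePos (treg d) <|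
          .seq (copyProg (vreg x) (treg (d + 1))) <| .seq (p.compile (d + 3)) <|
          .seq (.set (treg (d + 2)) 1) <| .seq (.sub (treg d) (treg d) (treg (d + 2)))
          (.add (treg (d + 1)) (treg (d + 1)) (treg (d + 2)))) u s' (r * (p.time n M + 6) + 1) ∧
          Keep d s s' ∧ decode s' = iter f k (decode s) := by
      intro r
      -- Induction on the rounds to go, with the round index and the state generalized.
      induction r with
      | zero =>
        intro i hi u hu _ hK hD
        obtain rfl : i = k := by omega
        exact ⟨u, ⟨1, by omega, .whileFalse hu⟩, hK, hD⟩
      | succ r ihr =>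
        intro i hi u hu hu' hK hD
        have hun : (u.setReg (vreg x) (u.reg (treg (d + 1)))).reg 0 = n := by
          have := congrArg Env.n (decode_setReg_vreg u x (u.reg (treg (d + 1))))
          rw [hD] at this
          refine this.trans ?_
          simp only [Env.setV]
          exact iter_induction (fun _ e => e.n = n) hn.symm
            fun i _ a ha => by simpa [hf, Env.setV] using ha
        have huM : (u.setReg (vreg x) (u.reg (treg (d + 1)))).reg 2 = M := by
          have := congrArg Env.M (decode_setReg_vreg u x (u.reg (treg (d + 1))))
          rw [hD] at this
          refine this.trans ?_
          simp only [Env.setV]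
          exact iter_induction (fun _ e => e.M = M) hM.symm
            fun i _ a ha => by simpa [hf, Env.setV] using ha
        obtain ⟨s₁, h₁, g₁, e₁⟩ := ih (d + 3) (u.setReg (vreg x) (u.reg (treg (d + 1))))
        rw [hun, huM] at h₁
        rw [decode_setReg_vreg, hu', hD] at e₁
        have g₂ := (keep_setReg_vreg (d + 3) u x (u.reg (treg (d + 1)))).trans g₁ le_rfl
        have hb := (within_copy (i := vreg x) (j := treg (d + 1))
          (by simp only [treg, vreg]; omega) u).seq (h₁.seq
          ((Within.of_exec (.set (treg (d + 2)) 1 _)).seq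
          ((Within.of_exec (.sub (treg d) (treg d) (treg (d + 2)) _)).seq
          (Within.of_exec (.add (treg (d + 1)) (treg (d + 1)) (treg (d + 2)) _)))))
        have n1 : treg d ≠ treg (d + 1) := by simp
        have n2 : treg d ≠ treg (d + 2) := by simp
        have n3 : treg (d + 1) ≠ treg (d + 2) := by simp
        set w := ((s₁.setReg (treg (d + 2)) 1).setReg (treg d)
          ((s₁.setReg (treg (d + 2)) 1).reg (treg d) -
            (s₁.setReg (treg (d + 2)) 1).reg (treg (d + 2)))) with hw
        have g₃ : Agree d s₁ (w.setReg (treg (d + 1)) (w.reg (treg (d + 1)) +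
            w.reg (treg (d + 2)))) :=
          ((Agree.setReg (j := d + 2) s₁ (by omega) 1).trans
            (.setReg (j := d) _ (by omega) _) le_rfl).trans
            (.setReg (j := d + 1) _ (by omega) _) le_rfl
        obtain ⟨s', hs', k', e'⟩ := ihr (i + 1) (by omega) _ (by
            simp only [hw, State.setReg, Function.update_apply, n1, n2, n3, n1.symm, n2.symm,
              if_true, if_false]
            rw [g₂ d (by omega), hu]; omega) (by
            simp only [hw, State.setReg, Function.update_apply, n2, n3, n1.symm, n2.symm,
              if_true, if_false]
            rw [g₂ (d + 1) (by omega), hu'])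
          ((hK.trans g₂ (by omega)).trans (g₃.keep le_rfl) le_rfl)
          (by rw [g₃.decode_eq, e₁]; rfl)
        refine ⟨s', (Within.whileTrue (by omega) hb hs').mono ?_, k', e'⟩
        rw [Nat.succ_mul]; omega
    have hbd : s.reg (if m then 2 else 0) = k := by
      cases m <;> rfl
    have hc := within_copy (i := treg d) (j := if m then 2 else 0)
      (by split_ifs <;> simp only [treg] <;> omega) s
    rw [hbd] at hc
    have n1 : treg d ≠ treg (d + 1) := by simp
    have g := (Agree.setReg (d := d) s le_rfl k).trans (.setReg (j := d + 1) _ (by omega) 0) le_rfl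
    obtain ⟨s', h', k', e'⟩ := key k 0 (by omega)
      ((s.setReg (treg d) k).setReg (treg (d + 1)) 0)
      (by simp [State.setReg]) (by simp) (g.keep le_rfl)
      g.decode_eq
    refine ⟨s', (hc.seq ((Within.of_exec (.set _ _ _)).seq h')).mono ?_, k', e'⟩
    simp only [time]
    have := Nat.mul_le_mul_right (p.time n M + 6) hkn
    omega

/-- The nesting of loops is fixed by the command, and a loop has at most n + M rounds, so it raises
the degree by one. -/
theorem Cmd.time_le (c : Cmd) : ∃ K k : ℕ, ∀ n M, c.time n M ≤ K * (n + M + 1) ^ k := by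
  induction c with
  | assign x a => exact ⟨a.time + 2, 0, fun n M => by simp [time]⟩
  | put a i y => exact ⟨y.time + (i.time + (6 + 1)), 0, fun n M => by simp [time]⟩
  | out i y => exact ⟨y.time + (i.time + (1 + (1 + 1))), 0, fun n M => by simp [time]⟩
  | skip => exact ⟨1, 0, fun n M => by simp [time]⟩
  | seq p q hp hq =>
    obtain ⟨K, k, h⟩ := hp
    obtain ⟨L, l, h'⟩ := hq
    refine ⟨K + L, k + l, fun n M => ?_⟩
    have h1 : (n + M + 1) ^ k ≤ (n + M + 1) ^ (k + l) := Nat.pow_le_pow_right (by omega) (by omega)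
    have h2 : (n + M + 1) ^ l ≤ (n + M + 1) ^ (k + l) := Nat.pow_le_pow_right (by omega) (by omega)
    have := (h n M).trans (Nat.mul_le_mul_left K h1)
    have := (h' n M).trans (Nat.mul_le_mul_left L h2)
    rw [time, Nat.add_mul]; omega
  | ite a p q hp hq =>
    obtain ⟨K, k, h⟩ := hp
    obtain ⟨L, l, h'⟩ := hq
    refine ⟨K + L + (a.time + 1), k + l, fun n M => ?_⟩
    have h1 : (n + M + 1) ^ k ≤ (n + M + 1) ^ (k + l) := Nat.pow_le_pow_right (by omega) (by omega)
    have h2 : (n + M + 1) ^ l ≤ (n + M + 1) ^ (k + l) := Nat.pow_le_pow_right (by omega) (by omega)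
    have h3 : 1 ≤ (n + M + 1) ^ (k + l) := Nat.one_le_pow _ _ (by omega)
    have := (h n M).trans (Nat.mul_le_mul_left K h1)
    have := (h' n M).trans (Nat.mul_le_mul_left L h2)
    have := Nat.mul_le_mul_left (a.time + 1) h3
    rw [time, Nat.add_mul, Nat.add_mul]; omega
  | loop m x p hp =>
    obtain ⟨K, k, h⟩ := hp
    refine ⟨K + 6 + 4, k + 1, fun n M => ?_⟩
    have h1 : 1 ≤ (n + M + 1) ^ k := Nat.one_le_pow _ _ (by omega)
    have h3 : 1 ≤ (n + M + 1) ^ (k + 1) := Nat.one_le_pow _ _ (by omega)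
    have h2 : p.time n M + 6 ≤ (K + 6) * (n + M + 1) ^ k := by
      have := h n M
      rw [Nat.add_mul]; omega
    have : (n + M) * (p.time n M + 6) ≤ (K + 6) * (n + M + 1) ^ (k + 1) :=
      calc (n + M) * (p.time n M + 6) ≤ (n + M + 1) * ((K + 6) * (n + M + 1) ^ k) :=
            Nat.mul_le_mul (by omega) h2
        _ = _ := by ring
    rw [time, Nat.add_mul (K + 6)]; omega


/-! ### Reasoning about commands -/

section simp_lemmas

variable (e : Env) (x y a i : ℕ) (k l : Fin 8)

@[simp] theorem setV_v : (e.setV x a).v y = if y = x then a else e.v y := by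
  simp [Env.setV, Function.update_apply]
@[simp] theorem setV_n : (e.setV x a).n = e.n := rfl
@[simp] theorem setV_M : (e.setV x a).M = e.M := rfl
@[simp] theorem setV_b : (e.setV x a).b = e.b := rfl
@[simp] theorem setV_arr : (e.setV x a).arr = e.arr := rfl
@[simp] theorem setV_inp : (e.setV x a).inp = e.inp := rfl
@[simp] theorem setA_v : (e.setA k i a).v = e.v := rfl
@[simp] theorem setA_n : (e.setA k i a).n = e.n := rfl
@[simp] theorem setA_M : (e.setA k i a).M = e.M := rfl
@[simp] theorem setA_arr :
    (e.setA k i a).arr l = if l = k then Function.update (e.arr k) i a else e.arr l := by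
  simp only [Env.setA, Function.update_apply]
@[simp] theorem bound_true : e.bound true = e.M := rfl
@[simp] theorem bound_false : e.bound false = e.n := rfl

end simp_lemmas

namespace Cmd

variable {a i y : Expr} {c d : Cmd} {e : Env} {x : ℕ} {k : Fin 8}

theorem eval_ite_pos (h : 0 < a.eval e) : (ite a c d).eval e = c.eval e := if_pos h
theorem eval_ite_neg (h : ¬ 0 < a.eval e) : (ite a c d).eval e = d.eval e := if_neg h
theorem eval_seq : (seq c d).eval e = d.eval (c.eval e) := rfl
theorem eval_assign : (assign x a).eval e = e.setV x (a.eval e) := rfl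
theorem eval_put : (put k i y).eval e = e.setA k (i.eval e) (y.eval e) := rfl
theorem eval_out : (out i y).eval e = e.setI (i.eval e) (y.eval e) := rfl
theorem eval_skip : skip.eval e = e := rfl

end Cmd

/-- The environment `a` differs from `e` only in what the command `c` may change. -/
structure Frame (c : Cmd) (e a : Env) : Prop where
  n : a.n = e.n
  M : a.M = e.M
  b : a.b = e.b
  v : ∀ {y}, y ∉ c.vars → a.v y = e.v y
  arr : ∀ {k}, k ∉ c.arrs → a.arr k = e.arr k
  inp : c.outs = false → a.inp = e.inp

theorem Cmd.frame (c : Cmd) (e : Env) : Frame c e (c.eval e) :=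
  ⟨by simp, by simp, by simp, c.eval_v e, c.eval_arr e, c.eval_inp e⟩

/-- The invariant rule for loops. -/
theorem loop_rule {m : Bool} {x : ℕ} {c : Cmd} {e : Env} (I : ℕ → Env → Prop) (h0 : I 0 e)
    (hs : ∀ i < e.bound m, ∀ a, Frame (.loop m x c) e a → I i a →
      I (i + 1) (c.eval (a.setV x i))) :
    I (e.bound m) ((Cmd.loop m x c).eval e) := by
  refine (iter_induction (fun i a => Frame (.loop m x c) e a ∧ I i a)
    ⟨⟨rfl, rfl, rfl, fun _ => rfl, fun _ => rfl, fun _ => rfl⟩, h0⟩ ?_).2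
  rintro i hi a ⟨hf, ha⟩
  refine ⟨⟨?_, ?_, ?_, ?_, ?_, ?_⟩, hs i hi a hf ha⟩
  · simpa using hf.n
  · simpa using hf.M
  · simpa using hf.b
  · intro y hy
    have hy' := hy
    simp only [Cmd.vars, List.mem_cons, not_or] at hy'
    rw [c.eval_v _ hy'.2, setV_v, if_neg hy'.1, hf.v hy]
  · intro k hk
    rw [c.eval_arr _ (by simpa [Cmd.arrs] using hk), setV_arr, hf.arr hk]
  · intro ho
    rw [c.eval_inp _ (by simpa [Cmd.outs] using ho), setV_inp, hf.inp ho]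

/-- Array `0` and the input array of the environment represent the relation `A`. -/
def Rep (A : ℕ → ℕ → Prop) (e : Env) : Prop :=
  -- Array 0 holds the offsets of the matrix rows, since the machine cannot multiply.
  ∀ u < e.n, ∀ w < e.n, 0 < e.inp (e.arr 0 u + w) ↔ A u w

theorem Rep.frame {A : ℕ → ℕ → Prop} {c : Cmd} {e a : Env} (h : Rep A e) (hf : Frame c e a)
    (h0 : 0 ∉ c.arrs) (ho : c.outs = false) : Rep A a := by
  intro u hu w hw
  rw [hf.n] at hu hw
  rw [hf.arr h0, hf.inp ho]
  exact h u hu w hw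

theorem Rep.eval {A : ℕ → ℕ → Prop} {e : Env} (h : Rep A e) (c : Cmd)
    (h0 : 0 ∉ c.arrs) (ho : c.outs = false) : Rep A (c.eval e) :=
  h.frame (c.frame e) h0 ho

theorem Rep.setV {A : ℕ → ℕ → Prop} {e : Env} (h : Rep A e) (x a : ℕ) : Rep A (e.setV x a) := h

/-- Test for adjacency. -/
def adjE (u w : Expr) : Expr := .inp (.add (.get 0 u) w)

/-- Test for being distinct. -/
def neE (a b : Expr) : Expr := .add (.sub a b) (.sub b a)

theorem adjE_pos {A : ℕ → ℕ → Prop} {e : Env} (h : Rep A e) {x y : ℕ}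
    (hx : e.v x < e.n) (hy : e.v y < e.n) :
    0 < (adjE (.var x) (.var y)).eval e ↔ A (e.v x) (e.v y) := h _ hx _ hy

theorem neE_pos {e : Env} (a b : Expr) : 0 < (neE a b).eval e ↔ a.eval e ≠ b.eval e := by
  simp only [neE, Expr.eval]; omega

/-! ### Partial colorings and propagation -/

/-- `χ` is a proper coloring of the first `n` vertices with the colors `1`, `2`, `3`. -/
structure IsCol (A : ℕ → ℕ → Prop) (n : ℕ) (χ : ℕ → ℕ) : Prop where
  pos : ∀ v < n, 1 ≤ χ v
  le : ∀ v < n, χ v ≤ 3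
  proper : ∀ u < n, ∀ w < n, A u w → χ u ≠ χ w

/-- The partial coloring `col`, where `0` means uncolored, is a part of `χ`. -/
def Ext (n : ℕ) (col χ : ℕ → ℕ) : Prop := ∀ v < n, col v ≠ 0 → χ v = col v

/-- Vertex `w` has a neighbor of color `c`. -/
def Sees (A : ℕ → ℕ → Prop) (n : ℕ) (col : ℕ → ℕ) (w c : ℕ) : Prop :=
  ∃ u < n, A w u ∧ col u = c

/-- Vertex `w` has neighbors of two different colors. -/
def SeesTwo (A : ℕ → ℕ → Prop) (n : ℕ) (col : ℕ → ℕ) (w : ℕ) : Prop :=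
  (Sees A n col w 1 ∧ Sees A n col w 2) ∨ (Sees A n col w 1 ∧ Sees A n col w 3) ∨
    (Sees A n col w 2 ∧ Sees A n col w 3)

/-- No uncolored vertex has neighbors of two different colors. -/
def IsClosedCol (A : ℕ → ℕ → Prop) (n : ℕ) (col : ℕ → ℕ) : Prop :=
  ∀ w < n, col w = 0 → ¬ SeesTwo A n col w

/-- No edge has two ends of the same color. -/
def NoConflict (A : ℕ → ℕ → Prop) (n : ℕ) (col : ℕ → ℕ) : Prop :=
  ∀ u < n, ∀ w < n, A u w → col u ≠ 0 → col u ≠ col w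

/-- Every vertex is colored or has a colored neighbor. -/
def Dominated (A : ℕ → ℕ → Prop) (n : ℕ) (col : ℕ → ℕ) : Prop :=
  ∀ u < n, col u ≠ 0 ∨ ∃ w < n, A u w ∧ col w ≠ 0

/-- The number of uncolored vertices. -/
def uncolored (n : ℕ) (col : ℕ → ℕ) : ℕ := ((Finset.range n).filter fun w => col w = 0).card

/-- The effect of the propagation at vertex `w`. -/
def Step (A : ℕ → ℕ → Prop) (n w : ℕ) (col col' : ℕ → ℕ) : Prop :=
  (col' = col ∧ (col w = 0 → ¬ SeesTwo A n col w)) ∨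
  (col w = 0 ∧ SeesTwo A n col w ∧ ∃ k, 1 ≤ k ∧ k ≤ 3 ∧ col' = Function.update col w k ∧
    ∀ j, 1 ≤ j → j ≤ 3 → j ≠ k → Sees A n col w j)

section partial_colorings

variable {A : ℕ → ℕ → Prop} {n w : ℕ} {col col' col'' χ : ℕ → ℕ}

theorem Ext.trans (h : Ext n col col') (h' : Ext n col' col'') : Ext n col col'' := by
  intro v hv h0
  have h1 := h v hv h0
  rw [h' v hv (by omega), h1]

theorem Step.ext (h : Step A n w col col') : Ext n col col' := by
  rcases h with ⟨rfl, -⟩ | ⟨h0, -, k, -, -, rfl, -⟩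
  · exact fun _ _ _ => rfl
  · intro v _ hv'
    rw [Function.update_of_ne]
    rintro rfl; exact hv' h0

/-- The vertex gets color `k` only if it sees both other colors. As χ has these colors on the
neighbors in question, it must use `k` here. -/
theorem Step.ext_of_isCol (h : Step A n w col col') (hw : w < n) (hχ : IsCol A n χ)
    (hc : Ext n col χ) : Ext n col' χ := by
  rcases h with ⟨rfl, -⟩ | ⟨h0, -, k, hk, hk', rfl, hs⟩
  · exact hc
  · intro v hv hv'
    by_cases hvw : v = w
    · subst hvw
      rw [Function.update_self]
      by_contra hne
      obtain ⟨u, hu, ha, hcu⟩ := hs (χ v) (hχ.pos v hv) (hχ.le v hv) hne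
      have := hχ.pos v hv
      exact hχ.proper v hv u hu ha (by rw [hc u hu (by omega), hcu])
    · rw [Function.update_of_ne hvw] at hv' ⊢
      exact hc v hv hv'

theorem uncolored_update_lt (hw : w < n) (h0 : col w = 0) {k : ℕ} (hk : 1 ≤ k) :
    uncolored n (Function.update col w k) < uncolored n col := by
  refine Finset.card_lt_card ((Finset.ssubset_iff_of_subset ?_).2 ⟨w, by simp [hw, h0], ?_⟩)
  · intro v
    simp only [Finset.mem_filter, Finset.mem_range]
    rintro ⟨hv, h⟩
    refine ⟨hv, ?_⟩
    by_cases hvw : v = w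
    · rw [hvw, h0]
    · rwa [Function.update_of_ne hvw] at h
  · simp; omega

/-- A partial coloring that extends to a proper coloring still does so after a closed conflict-free
extension, provided that it dominates all vertices. -/
theorem exists_isCol_of_closed (hA : ∀ u w, A u w → A w u) (hχ : IsCol A n χ)
    (hc : Ext n col χ) (hdom : Dominated A n col) (hext : Ext n col col')
    (hle : ∀ v < n, col' v ≤ 3) (hclosed : IsClosedCol A n col')
    (hnc : NoConflict A n col') : ∃ χ', IsCol A n χ' ∧ Ext n col' χ' := by
  -- An uncolored `w` has a neighbor `z` that was colored from the start, so χ gives `z` and `w`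
  -- different colors. If `u` had the color χ w, then `w` would see the two different colors of `u`
  -- and `z`, against closedness.
  have key : ∀ u < n, ∀ w < n, A u w → col' u ≠ 0 → col' w = 0 → col' u ≠ χ w := by
    intro u hu w hw ha hu0 hw0 he
    have hw1 : col w = 0 := by
      by_contra h
      have := hext w hw h
      omega
    obtain h | ⟨z, hz, haz, hz0⟩ := hdom w hw
    · exact h hw1
    have hz1 := hext z hz hz0
    have hz2 := hc z hz hz0
    have hz3 := hχ.proper w hw z hz haz
    have hu1 := hle u hu
    have hz4 := hle z hz
    have s1 : Sees A n col' w (col' u) := ⟨u, hu, hA _ _ ha, rfl⟩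
    have s2 : Sees A n col' w (col' z) := ⟨z, hz, haz, rfl⟩
    have hne : col' u ≠ col' z := by omega
    have hz0' : col' z ≠ 0 := by omega
    refine hclosed w hw hw0 ?_
    unfold SeesTwo
    generalize col' u = a at *
    generalize col' z = b at *
    interval_cases a <;> interval_cases b <;> simp_all
  -- The new partial coloring overwrites χ. Edges between the two parts are proper by `key`, those
  -- inside the new part by the absence of conflicts.
  refine ⟨fun v => if col' v = 0 then χ v else col' v, ⟨?_, ?_, ?_⟩, ?_⟩
  · intro v hv
    have := hχ.pos v hv
    split_ifs <;> omega
  · intro v hv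
    have := hχ.le v hv
    have := hle v hv
    split_ifs <;> omega
  · intro u hu w hw ha
    split_ifs with h1 h2 h2
    · exact hχ.proper u hu w hw ha
    · exact (key w hw u hu (hA _ _ ha) h2 h1).symm
    · exact key u hu w hw ha h1 h2
    · exact hnc u hu w hw ha h1
  · intro v _ h
    simp [h]

end partial_colorings

/-! ### Propagation of forced colors as a program. -/

/-- Record in array `5` the colors of the neighbors of the vertex in variable `1`. -/
def seenCmd : Cmd :=
  .seq (.put 5 (.const 1) (.const 0)) <| .seq (.put 5 (.const 2) (.const 0)) <|
  .seq (.put 5 (.const 3) (.const 0)) <|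
  -- Uncolored neighbors mark cell 0, which is never read.
  .loop false 0 (.ite (adjE (.var 1) (.var 0)) (.put 5 (.get 3 (.var 0)) (.const 1)) .skip)

theorem seenCmd_spec {A : ℕ → ℕ → Prop} {e : Env} (h : Rep A e) (hw : e.v 1 < e.n) :
    ∀ c, 1 ≤ c → c ≤ 3 → (0 < (seenCmd.eval e).arr 5 c ↔ Sees A e.n (e.arr 3) (e.v 1) c) := by
  set e₁ := ((e.setA 5 1 0).setA 5 2 0).setA 5 3 0 with he₁
  have hr₁ : Rep A e₁ := h
  refine loop_rule (m := false) (x := 0) (c := .ite (adjE (.var 1) (.var 0))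
    (.put 5 (.get 3 (.var 0)) (.const 1)) .skip) (e := e₁)
    (fun i a => ∀ c, 1 ≤ c → c ≤ 3 →
      (0 < a.arr 5 c ↔ ∃ u < i, A (e.v 1) u ∧ e.arr 3 u = c)) ?_ ?_
  · intro c h1 h3
    interval_cases c <;> simp [he₁]
  · intro i hi a hf ih c h1 h3
    have hv : a.v 1 = e.v 1 := hf.v (by decide)
    have ha3 : a.arr 3 = e.arr 3 := hf.arr (by decide)
    have hr : Rep A (a.setV 0 i) := (hr₁.frame hf (by decide) rfl).setV 0 i
    have hn : a.n = e.n := hf.n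
    have hi' : i < e.n := hi
    have ht := adjE_pos hr (x := 1) (y := 0) (by simpa [hn, hv] using hw) (by simpa [hn])
    simp only [setV_v, hv] at ht
    norm_num at ht
    have hsucc : (∃ u < i + 1, A (e.v 1) u ∧ e.arr 3 u = c) ↔
        (∃ u < i, A (e.v 1) u ∧ e.arr 3 u = c) ∨ (A (e.v 1) i ∧ e.arr 3 i = c) := by
      simp only [Nat.lt_succ_iff_lt_or_eq, or_and_right, exists_or, exists_eq_left]
    rw [hsucc, ← ih c h1 h3]
    by_cases hadj : A (e.v 1) i
    · rw [Cmd.eval_ite_pos (ht.2 hadj)]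
      simp only [Cmd.eval_put, Expr.eval, setA_arr, setV_arr, setV_v, if_true, ha3, hadj,
        true_and, Function.update_apply]
      split_ifs with hc
      · simp [hc]
      · simp [Ne.symm hc]
    · rw [Cmd.eval_ite_neg (mt ht.1 hadj)]
      simp [hadj, Cmd.eval_skip]

/-- Propagation at the vertex in variable `1`. -/
def stepCmd : Cmd :=
  .ite (.get 3 (.var 1)) .skip <| .seq seenCmd <|
  .ite (.get 5 (.const 1))
    (.ite (.get 5 (.const 2)) (.put 3 (.var 1) (.const 3))
      (.ite (.get 5 (.const 3)) (.put 3 (.var 1) (.const 2)) .skip))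
    (.ite (.get 5 (.const 2))
      (.ite (.get 5 (.const 3)) (.put 3 (.var 1) (.const 1)) .skip) .skip)

/-- If all three colors are seen, the vertex still gets one of them. This fits `Step`, and the
resulting conflict is left to the later check. -/
theorem stepCmd_spec {A : ℕ → ℕ → Prop} {e : Env} (h : Rep A e) (hw : e.v 1 < e.n) :
    Step A e.n (e.v 1) (e.arr 3) ((stepCmd.eval e).arr 3) := by
  unfold stepCmd
  by_cases h0 : 0 < e.arr 3 (e.v 1)
  · rw [Cmd.eval_ite_pos (by exact h0)]
    exact .inl ⟨rfl, fun h => by omega⟩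
  rw [Cmd.eval_ite_neg (by exact h0), Cmd.eval_seq]
  replace h0 : e.arr 3 (e.v 1) = 0 := by omega
  have hl := seenCmd_spec h hw
  have hf := Cmd.frame seenCmd e
  generalize seenCmd.eval e = e₂ at hl hf ⊢
  have hv : e₂.v 1 = e.v 1 := hf.v (by decide)
  have ha3 : e₂.arr 3 = e.arr 3 := hf.arr (by decide)
  have s1 := hl 1 (by omega) (by omega)
  have s2 := hl 2 (by omega) (by omega)
  have s3 := hl 3 (by omega) (by omega)
  have hput : ∀ k, ((Cmd.put 3 (.var 1) (.const k)).eval e₂).arr 3 =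
      Function.update (e.arr 3) (e.v 1) k := by
    simp [Cmd.eval_put, Expr.eval, hv, ha3]
  unfold Step SeesTwo
  simp only [← s1, ← s2, ← s3]
  by_cases c1 : 0 < e₂.arr 5 1
  · rw [Cmd.eval_ite_pos (by exact c1)]
    by_cases c2 : 0 < e₂.arr 5 2
    · rw [Cmd.eval_ite_pos (by exact c2), hput]
      refine .inr ⟨h0, .inl ⟨c1, c2⟩, 3, by omega, by omega, rfl, ?_⟩
      intro j _ _ _; interval_cases j <;> simp_all
    rw [Cmd.eval_ite_neg (by exact c2)]
    by_cases c3 : 0 < e₂.arr 5 3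
    · rw [Cmd.eval_ite_pos (by exact c3), hput]
      refine .inr ⟨h0, .inr (.inl ⟨c1, c3⟩), 2, by omega, by omega, rfl, ?_⟩
      intro j _ _ _; interval_cases j <;> simp_all
    · rw [Cmd.eval_ite_neg (by exact c3)]
      exact .inl ⟨ha3, fun _ => by tauto⟩
  · rw [Cmd.eval_ite_neg (by exact c1)]
    by_cases c2 : 0 < e₂.arr 5 2
    · rw [Cmd.eval_ite_pos (by exact c2)]
      by_cases c3 : 0 < e₂.arr 5 3
      · rw [Cmd.eval_ite_pos (by exact c3), hput]
        refine .inr ⟨h0, .inr (.inr ⟨c2, c3⟩), 1, by omega, by omega, rfl, ?_⟩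
        intro j _ _ _; interval_cases j <;> simp_all
      · rw [Cmd.eval_ite_neg (by exact c3)]
        exact .inl ⟨ha3, fun _ => by tauto⟩
    · rw [Cmd.eval_ite_neg (by exact c2)]
      exact .inl ⟨ha3, fun _ => by tauto⟩

/-- Propagation at all vertices, repeated `n` times. -/
def propagateCmd : Cmd := .loop false 2 (.loop false 1 stepCmd)

/-- The effect of propagation. -/
structure Propagates (A : ℕ → ℕ → Prop) (n : ℕ) (col col' : ℕ → ℕ) : Prop where
  ext : Ext n col col'
  isCol : ∀ χ, IsCol A n χ → Ext n col χ → Ext n col' χ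
  le : (∀ v < n, col v ≤ 3) → ∀ v < n, col' v ≤ 3

theorem Propagates.refl (A : ℕ → ℕ → Prop) (n : ℕ) (col : ℕ → ℕ) : Propagates A n col col :=
  ⟨fun _ _ _ => rfl, fun _ _ h => h, fun h => h⟩

theorem Propagates.trans {A : ℕ → ℕ → Prop} {n : ℕ} {col col' col'' : ℕ → ℕ}
    (h : Propagates A n col col') (h' : Propagates A n col' col'') : Propagates A n col col'' :=
  ⟨h.ext.trans h'.ext, fun χ hχ hc => h'.isCol χ hχ (h.isCol χ hχ hc), fun hc => h'.le (h.le hc)⟩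

theorem Step.propagates {A : ℕ → ℕ → Prop} {n w : ℕ} {col col' : ℕ → ℕ}
    (h : Step A n w col col') (hw : w < n) : Propagates A n col col' := by
  refine ⟨h.ext, fun χ hχ hc => h.ext_of_isCol hw hχ hc, fun hc v hv => ?_⟩
  rcases h with ⟨rfl, -⟩ | ⟨h0, -, k, hk, hk', rfl, hs⟩
  · exact hc v hv
  · rw [Function.update_apply]
    split_ifs
    exacts [hk', hc v hv]

/-- A pass that changes nothing has tested every vertex against the same coloring, which is
therefore closed; any other pass colors at least one vertex. So a closed coloring is reached within
n passes. -/
theorem pass_spec {A : ℕ → ℕ → Prop} {e : Env} (h : Rep A e) :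
    Propagates A e.n (e.arr 3) (((Cmd.loop false 1 stepCmd).eval e).arr 3) ∧
    ((((Cmd.loop false 1 stepCmd).eval e).arr 3 = e.arr 3 ∧ IsClosedCol A e.n (e.arr 3)) ∨
      (¬ IsClosedCol A e.n (e.arr 3) ∧
        uncolored e.n (((Cmd.loop false 1 stepCmd).eval e).arr 3) < uncolored e.n (e.arr 3))) := by
  refine loop_rule (m := false) (fun i a => Propagates A e.n (e.arr 3) (a.arr 3) ∧
    ((a.arr 3 = e.arr 3 ∧ ∀ w < i, e.arr 3 w = 0 → ¬ SeesTwo A e.n (e.arr 3) w) ∨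
      (¬ IsClosedCol A e.n (e.arr 3) ∧ uncolored e.n (a.arr 3) < uncolored e.n (e.arr 3))))
    ⟨.refl _ _ _, .inl ⟨rfl, by omega⟩⟩ ?_
  rintro i hi a hf ⟨hp, ha⟩
  have hr : Rep A (a.setV 1 i) := (h.frame hf (by decide) rfl).setV 1 i
  have hn : a.n = e.n := hf.n
  have hi' : i < e.n := hi
  have hs := stepCmd_spec hr (by simpa [hn] using hi')
  simp only [setV_n, setV_v, if_true, setV_arr, hn] at hs
  refine ⟨hp.trans (hs.propagates hi'), ?_⟩
  rcases hs with ⟨hs, hs'⟩ | ⟨h0, h2, k, hk, -, hs, -⟩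
  · rw [hs]
    refine ha.imp_left fun hx => ⟨hx.1, fun w hw => ?_⟩
    obtain hw | rfl := Nat.lt_succ_iff_lt_or_eq.1 hw
    · exact hx.2 w hw
    · rwa [hx.1] at hs'
  · rw [hs]
    have hlt := uncolored_update_lt (n := e.n) hi' h0 hk
    rcases ha with ⟨ha, -⟩ | ⟨ha, ha'⟩
    · rw [ha] at h0 h2 hlt ⊢
      exact .inr ⟨fun hcl => hcl i hi' h0 h2, hlt⟩
    · exact .inr ⟨ha, hlt.trans ha'⟩

theorem propagateCmd_spec {A : ℕ → ℕ → Prop} {e : Env} (h : Rep A e) :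
    Propagates A e.n (e.arr 3) ((propagateCmd.eval e).arr 3) ∧
      IsClosedCol A e.n ((propagateCmd.eval e).arr 3) := by
  -- If closedness has not occurred after n passes, no uncolored vertex is left, and the coloring is
  -- closed for that reason.
  have hl := loop_rule (m := false) (x := 2) (c := .loop false 1 stepCmd) (e := e)
    (fun i a => Propagates A e.n (e.arr 3) (a.arr 3) ∧
      (IsClosedCol A e.n (a.arr 3) ∨ uncolored e.n (a.arr 3) + i ≤ e.n))
    ⟨.refl _ _ _, .inr ?_⟩ ?_
  · refine ⟨hl.1, hl.2.elim id fun h0 w hw hw0 => ?_⟩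
    have : uncolored e.n ((propagateCmd.eval e).arr 3) = 0 := by
      simp only [bound_false] at h0; unfold propagateCmd; omega
    simp only [uncolored, Finset.card_eq_zero, Finset.filter_eq_empty_iff, Finset.mem_range] at this
    exact (this hw hw0).elim
  · have := Finset.card_filter_le (Finset.range e.n) fun w => e.arr 3 w = 0
    simpa [uncolored] using this
  · rintro i hi a hf ⟨hp, ha⟩
    have hr : Rep A (a.setV 2 i) := (h.frame hf (by decide) rfl).setV 2 i
    have hn : a.n = e.n := hf.n
    obtain ⟨h1, h2⟩ := pass_spec hr
    simp only [setV_n, setV_arr, hn] at h1 h2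
    refine ⟨hp.trans h1, ?_⟩
    rcases h2 with ⟨h2, h3⟩ | ⟨h2, h3⟩
    · exact .inl (by rwa [h2])
    · exact .inr (by have := ha.resolve_left h2; omega)


/-! ### Limited backtracking -/

/-- Loops that lower a flag. -/
theorem loop_flag {m : Bool} {x f : ℕ} {c : Cmd} {e : Env} (P : ℕ → Prop)
    (hs : ∀ i < e.bound m, ∀ a, Frame (.loop m x c) e a →
      ((c.eval (a.setV x i)).v f = 0 ↔ a.v f = 0 ∧ P i)) :
    ((Cmd.loop m x c).eval e).v f = 0 ↔ e.v f = 0 ∧ ∀ i < e.bound m, P i := by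
  refine loop_rule (fun i a => a.v f = 0 ↔ e.v f = 0 ∧ ∀ j < i, P j) (by simp) ?_
  intro i hi a hf ih
  rw [hs i hi a hf, ih, and_assoc]
  refine and_congr_right fun _ => ?_
  simp only [Nat.lt_succ_iff_lt_or_eq, or_imp, forall_and, forall_eq]

/-- Search for edges with ends of the same color, starting from the vertex in variable `0`. -/
def checkVertexCmd : Cmd :=
  .loop false 1 <| .ite (adjE (.var 0) (.var 1))
    (.ite (.get 3 (.var 0)) (.ite (neE (.get 3 (.var 0)) (.get 3 (.var 1))) .skip
      (.assign 3 (.const 1))) .skip) .skip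

theorem checkVertexCmd_spec {A : ℕ → ℕ → Prop} {e : Env} (h : Rep A e) (hu : e.v 0 < e.n) :
    (checkVertexCmd.eval e).v 3 = 0 ↔ e.v 3 = 0 ∧ ∀ w < e.n,
      A (e.v 0) w → e.arr 3 (e.v 0) ≠ 0 → e.arr 3 (e.v 0) ≠ e.arr 3 w := by
  refine loop_flag (m := false) (fun w => A (e.v 0) w → e.arr 3 (e.v 0) ≠ 0 →
    e.arr 3 (e.v 0) ≠ e.arr 3 w) ?_
  intro i hi a hf
  have hv : a.v 0 = e.v 0 := hf.v (by decide)
  have ha3 : a.arr 3 = e.arr 3 := hf.arr (by decide)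
  have hr : Rep A (a.setV 1 i) := (h.frame hf (by decide) rfl).setV 1 i
  have hn : a.n = e.n := hf.n
  have hi' : i < e.n := hi
  have ht := adjE_pos hr (x := 0) (y := 1) (by simpa [hn, hv] using hu) (by simpa [hn])
  simp only [setV_v, hv] at ht
  norm_num at ht
  by_cases c1 : A (e.v 0) i
  · rw [Cmd.eval_ite_pos (ht.2 c1)]
    by_cases c2 : 0 < e.arr 3 (e.v 0)
    · rw [Cmd.eval_ite_pos (by simpa [Expr.eval, hv, ha3] using c2)]
      by_cases c3 : e.arr 3 (e.v 0) = e.arr 3 i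
      · rw [Cmd.eval_ite_neg (by rw [neE_pos]; simpa [Expr.eval, hv, ha3] using c3)]
        simp [Cmd.eval_assign, Expr.eval, c1, c3]
        omega
      · rw [Cmd.eval_ite_pos (by rw [neE_pos]; simpa [Expr.eval, hv, ha3] using c3)]
        simp [Cmd.eval_skip, c3]
    · rw [Cmd.eval_ite_neg (by simpa [Expr.eval, hv, ha3] using c2)]
      simp [Cmd.eval_skip, show e.arr 3 (e.v 0) = 0 by omega]
  · rw [Cmd.eval_ite_neg (mt ht.1 c1)]
    simp [Cmd.eval_skip, c1]

/-- Search for edges with ends of the same color. -/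
def checkCmd : Cmd := .seq (.assign 3 (.const 0)) (.loop false 0 checkVertexCmd)

theorem checkCmd_spec {A : ℕ → ℕ → Prop} {e : Env} (h : Rep A e) :
    (checkCmd.eval e).v 3 = 0 ↔ NoConflict A e.n (e.arr 3) := by
  have := loop_flag (m := false) (x := 0) (f := 3) (c := checkVertexCmd) (e := e.setV 3 0)
    (fun u => ∀ w < e.n, A u w → e.arr 3 u ≠ 0 → e.arr 3 u ≠ e.arr 3 w) (by
      intro i hi a hf
      have ha3 : a.arr 3 = e.arr 3 := hf.arr (by decide)
      have hr : Rep A (a.setV 0 i) := ((h.setV 3 0).frame hf (by decide) rfl).setV 0 i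
      have hn : a.n = e.n := hf.n
      have hi' : i < e.n := hi
      rw [checkVertexCmd_spec hr (by simpa [hn])]
      simp [hn, ha3])
  refine Iff.trans this ?_
  simp [NoConflict]

/-- Search for vertices without a color in `{1, 2, 3}`. -/
def checkRangeCmd : Cmd :=
  .loop false 0 <| .ite (.get 3 (.var 0))
    (.ite (.sub (.get 3 (.var 0)) (.const 3)) (.assign 3 (.const 1)) .skip)
    (.assign 3 (.const 1))

theorem checkRangeCmd_spec (e : Env) :
    (checkRangeCmd.eval e).v 3 = 0 ↔ e.v 3 = 0 ∧ ∀ u < e.n, 1 ≤ e.arr 3 u ∧ e.arr 3 u ≤ 3 := by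
  refine loop_flag (m := false) (fun u => 1 ≤ e.arr 3 u ∧ e.arr 3 u ≤ 3) ?_
  intro i hi a hf
  have ha3 : a.arr 3 = e.arr 3 := hf.arr (by decide)
  by_cases c1 : 0 < e.arr 3 i
  · rw [Cmd.eval_ite_pos (by simpa [Expr.eval, ha3] using c1)]
    by_cases c2 : 3 < e.arr 3 i
    · rw [Cmd.eval_ite_pos (by simpa [Expr.eval, ha3] using c2)]
      simp [Cmd.eval_assign, Expr.eval]; omega
    · rw [Cmd.eval_ite_neg (by simpa [Expr.eval, ha3] using c2)]
      simp [Cmd.eval_skip]; omega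
  · rw [Cmd.eval_ite_neg (by simpa [Expr.eval, ha3] using c1)]
    simp [Cmd.eval_assign, Expr.eval]; omega

/-- Copy array `l` to array `k`. -/
def copyCmd (k l : Fin 8) : Cmd := .loop false 0 (.put k (.var 0) (.get l (.var 0)))

theorem copyCmd_spec {k l : Fin 8} (hkl : l ≠ k) (e : Env) :
    ∀ u < e.n, ((copyCmd k l).eval e).arr k u = e.arr l u := by
  refine loop_rule (m := false) (fun i a => ∀ u < i, a.arr k u = e.arr l u) (by omega) ?_
  intro i hi a hf ih u hu
  have hl : a.arr l = e.arr l := hf.arr (by simpa [Cmd.arrs] using hkl)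
  simp only [Cmd.eval_put, Expr.eval, setV_v, setV_arr, setA_arr, if_true, hl]
  obtain hu | rfl := Nat.lt_succ_iff_lt_or_eq.1 hu
  · rw [Function.update_of_ne (by omega), ih u hu]
  · rw [Function.update_self]

/-- The partial coloring `col` dominates all vertices and is a part of the proper coloring `χ`. -/
structure IsPart (A : ℕ → ℕ → Prop) (n : ℕ) (col χ : ℕ → ℕ) : Prop where
  le : ∀ v < n, col v ≤ 3
  dom : Dominated A n col
  isCol : IsCol A n χ
  ext : Ext n col χ

/-- Color the vertex in variable `4` with color `k`, and propagate; undo this in case of a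
conflict. -/
def tryCmd (k : ℕ) : Cmd :=
  .ite (.get 3 (.var 4)) .skip <| .seq (copyCmd 4 3) <| .seq (.put 3 (.var 4) (.const k)) <|
    .seq propagateCmd <| .seq checkCmd <| .ite (.var 3) (copyCmd 3 4) .skip

theorem Dominated.ext {A : ℕ → ℕ → Prop} {n : ℕ} {col col' : ℕ → ℕ} (h : Dominated A n col)
    (he : Ext n col col') : Dominated A n col' := by
  have key : ∀ w < n, col w ≠ 0 → col' w ≠ 0 := fun w hw h0 => by rwa [he w hw h0]
  intro u hu
  obtain h0 | ⟨w, hw, ha, h0⟩ := h u hu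
  · exact .inl (key u hu h0)
  · exact .inr ⟨w, hw, ha, key w hw h0⟩

/-- The variables and arrays that a trial may change do not depend on the color, so `decide` can
settle membership on a closed term. -/
theorem tryCmd_vars (k : ℕ) : (tryCmd k).vars = (tryCmd 0).vars := rfl

theorem tryCmd_arrs (k : ℕ) : (tryCmd k).arrs = (tryCmd 0).arrs := rfl

/-- A successful trial may replace the hypothetical coloring χ by another one, but an extension
still exists. A failed trial leaves χ intact and shows that χ avoids `k` at the vertex. The program
never knows χ. -/
theorem tryCmd_spec {A : ℕ → ℕ → Prop} (hA : ∀ u w, A u w → A w u) {e : Env} (h : Rep A e)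
    (hv : e.v 4 < e.n) {k : ℕ} (hk : 1 ≤ k) (hk' : k ≤ 3) {χ : ℕ → ℕ}
    (hp : IsPart A e.n (e.arr 3) χ) :
    Ext e.n (e.arr 3) (((tryCmd k).eval e).arr 3) ∧
    ∃ χ', IsPart A e.n (((tryCmd k).eval e).arr 3) χ' ∧
      (((tryCmd k).eval e).arr 3 (e.v 4) ≠ 0 ∨ (χ' = χ ∧ χ (e.v 4) ≠ k)) := by
  unfold tryCmd
  by_cases h0 : 0 < e.arr 3 (e.v 4)
  · rw [Cmd.eval_ite_pos (by exact h0), Cmd.eval_skip]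
    exact ⟨fun _ _ _ => rfl, χ, hp, .inl (by omega)⟩
  rw [Cmd.eval_ite_neg (by exact h0), Cmd.eval_seq, Cmd.eval_seq, Cmd.eval_seq, Cmd.eval_seq]
  replace h0 : e.arr 3 (e.v 4) = 0 := by omega
  have hc := copyCmd_spec (k := 4) (l := 3) (by decide) e
  have hf₁ := (copyCmd 4 3).frame e
  generalize (copyCmd 4 3).eval e = e₁ at hc hf₁ ⊢
  have hn₁ : e₁.n = e.n := hf₁.n
  have hv₁ : e₁.v 4 = e.v 4 := hf₁.v (by decide)
  have ha₁ : e₁.arr 3 = e.arr 3 := hf₁.arr (by decide)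
  have hr₁ : Rep A e₁ := h.frame hf₁ (by decide) rfl
  have hf₂ := (Cmd.put 3 (.var 4) (.const k)).frame e₁
  have hput : ((Cmd.put 3 (.var 4) (.const k)).eval e₁).arr 3 =
      Function.update (e.arr 3) (e.v 4) k := by
    simp [Cmd.eval_put, Expr.eval, hv₁, ha₁]
  have hext : Ext e.n (e.arr 3) (((Cmd.put 3 (.var 4) (.const k)).eval e₁).arr 3) := by
    rw [hput]
    intro v _ hv'
    rw [Function.update_of_ne]
    rintro rfl; exact hv' h0
  have hle : ∀ v < e.n, ((Cmd.put 3 (.var 4) (.const k)).eval e₁).arr 3 v ≤ 3 := by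
    intro v hv
    rw [hput, Function.update_apply]
    split_ifs
    exacts [hk', hp.le v hv]
  have hχk : χ (e.v 4) = k → Ext e.n (((Cmd.put 3 (.var 4) (.const k)).eval e₁).arr 3) χ := by
    intro hχ v hv hv0
    rw [hput, Function.update_apply] at hv0 ⊢
    split_ifs at hv0 ⊢ with hvv
    · rw [hvv, hχ]
    · exact hp.ext v hv hv0
  have hself : ((Cmd.put 3 (.var 4) (.const k)).eval e₁).arr 3 (e.v 4) ≠ 0 := by
    rw [hput, Function.update_self]; omega
  have hr₂ : Rep A ((Cmd.put 3 (.var 4) (.const k)).eval e₁) := hr₁.eval _ (by simp [Cmd.arrs]) rfl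
  have ha₂ : ((Cmd.put 3 (.var 4) (.const k)).eval e₁).arr 4 = e₁.arr 4 :=
    hf₂.arr (by simp [Cmd.arrs])
  have hn₂ := hf₂.n.trans hn₁
  generalize (Cmd.put 3 (.var 4) (.const k)).eval e₁ = e₂ at hext hle hχk hself hr₂ ha₂ hn₂ ⊢
  obtain ⟨hp₃, hcl⟩ := propagateCmd_spec hr₂
  have hf₃ := propagateCmd.frame e₂
  have hr₃ : Rep A (propagateCmd.eval e₂) := hr₂.eval _ (by decide) rfl
  have hn₃ := hf₃.n.trans hn₂
  have ha₃ : (propagateCmd.eval e₂).arr 4 = e₂.arr 4 := hf₃.arr (by decide)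
  rw [hn₂] at hp₃ hcl
  generalize propagateCmd.eval e₂ = e₃ at hp₃ hcl hr₃ hn₃ ha₃ ⊢
  have hch := checkCmd_spec hr₃
  have hf₄ := checkCmd.frame e₃
  have hn₄ := hf₄.n.trans hn₃
  have ha₄ : (checkCmd.eval e₃).arr 4 = e₃.arr 4 := hf₄.arr (by decide)
  have ha₄' : (checkCmd.eval e₃).arr 3 = e₃.arr 3 := hf₄.arr (by decide)
  rw [hn₃] at hch
  generalize checkCmd.eval e₃ = e₄ at hch hn₄ ha₄ ha₄' ⊢
  by_cases h4 : 0 < e₄.v 3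
  · rw [Cmd.eval_ite_pos (by exact h4)]
    have hres : ∀ u < e.n, ((copyCmd 3 4).eval e₄).arr 3 u = e.arr 3 u := by
      intro u hu
      rw [copyCmd_spec (by decide) e₄ u (by omega), ha₄, ha₃, ha₂, hc u hu]
    have he : Ext e.n (e.arr 3) (((copyCmd 3 4).eval e₄).arr 3) := fun u hu _ => hres u hu
    refine ⟨he, χ, ⟨fun v hv => by rw [hres v hv]; exact hp.le v hv, hp.dom.ext he, hp.isCol,
      fun v hv hv0 => ?_⟩, .inr ⟨rfl, fun hχ => ?_⟩⟩
    · rw [hres v hv] at hv0 ⊢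
      exact hp.ext v hv hv0
    -- If χ had color `k` at the vertex, all propagated colors would be colors of χ, which has no
    -- conflicts.
    · have hfin := hp₃.isCol χ hp.isCol (hχk hχ)
      refine h4.ne' (hch.2 fun u hu w hw ha hu0 heq => ?_)
      refine hp.isCol.proper u hu w hw ha ?_
      rw [hfin u hu hu0, hfin w hw (by omega), heq]
  · rw [Cmd.eval_ite_neg (by exact h4), Cmd.eval_skip, ha₄']
    have hext' := hext.trans hp₃.ext
    have hle' := hp₃.le hle
    obtain ⟨χ', h1, h2⟩ := exists_isCol_of_closed hA hp.isCol hp.ext hp.dom hext' hle' hcl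
      (hch.1 (by omega))
    exact ⟨hext', χ', ⟨hle', hp.dom.ext hext', h1, h2⟩, .inl (by
      rwa [hp₃.ext _ hv hself])⟩

/-- Complete a partial coloring. -/
def completeCmd : Cmd := .loop false 4 (.seq (tryCmd 1) (.seq (tryCmd 2) (tryCmd 3)))

theorem completeCmd_spec {A : ℕ → ℕ → Prop} (hA : ∀ u w, A u w → A w u) {e : Env} (h : Rep A e)
    {χ : ℕ → ℕ} (hp : IsPart A e.n (e.arr 3) χ) :
    ∃ χ', IsPart A e.n ((completeCmd.eval e).arr 3) χ' ∧
      ∀ v < e.n, (completeCmd.eval e).arr 3 v ≠ 0 := by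
  refine loop_rule (m := false) (fun i a => ∃ χ', IsPart A e.n (a.arr 3) χ' ∧
      ∀ v < i, a.arr 3 v ≠ 0) ⟨χ, hp, by omega⟩ ?_
  rintro i hi a hf ⟨χ₀, h₀, hd⟩
  have hr : Rep A (a.setV 4 i) := (h.frame hf (by decide) rfl).setV 4 i
  have hn : (a.setV 4 i).n = e.n := hf.n
  have hi' : i < e.n := hi
  have hv : (a.setV 4 i).v 4 = i := by simp
  replace h₀ : IsPart A e.n ((a.setV 4 i).arr 3) χ₀ := h₀
  replace hd : ∀ v < i, (a.setV 4 i).arr 3 v ≠ 0 := hd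
  generalize a.setV 4 i = a₀ at hr hn hv h₀ hd
  rw [Cmd.eval_seq, Cmd.eval_seq]
  have step : ∀ k, 1 ≤ k → k ≤ 3 → ∀ a : Env, Rep A a → a.n = e.n → a.v 4 = i → ∀ χ,
      IsPart A e.n (a.arr 3) χ → Rep A ((tryCmd k).eval a) ∧ ((tryCmd k).eval a).n = e.n ∧
      ((tryCmd k).eval a).v 4 = i ∧ Ext e.n (a.arr 3) (((tryCmd k).eval a).arr 3) ∧
      ∃ χ', IsPart A e.n (((tryCmd k).eval a).arr 3) χ' ∧
        (((tryCmd k).eval a).arr 3 i ≠ 0 ∨ (χ' = χ ∧ χ i ≠ k)) := by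
    intro k hk hk' a hr hn hv χ hp
    have hf := (tryCmd k).frame a
    have := tryCmd_spec hA hr (by omega) hk hk' (χ := χ) (by rwa [hn])
    rw [hn, hv] at this
    exact ⟨hr.frame hf (by rw [tryCmd_arrs]; decide) rfl, hf.n.trans hn,
      (hf.v (by rw [tryCmd_vars]; decide)).trans hv, this⟩
  obtain ⟨r₁, n₁, v₁, x₁, χ₁, p₁, q₁⟩ := step 1 le_rfl (by omega) a₀ hr hn hv χ₀ h₀
  obtain ⟨r₂, n₂, v₂, x₂, χ₂, p₂, q₂⟩ := step 2 (by omega) (by omega) _ r₁ n₁ v₁ χ₁ p₁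
  obtain ⟨-, -, -, x₃, χ₃, p₃, q₃⟩ := step 3 (by omega) (by omega) _ r₂ n₂ v₂ χ₂ p₂
  generalize (tryCmd 3).eval _ = a₃ at *
  generalize (tryCmd 2).eval _ = a₂ at *
  generalize (tryCmd 1).eval _ = a₁ at *
  refine ⟨χ₃, p₃, fun v hv' => ?_⟩
  obtain hv' | rfl := Nat.lt_succ_iff_lt_or_eq.1 hv'
  · rw [(((x₁.trans x₂).trans x₃) v (by omega) (hd v hv'))]
    exact hd v hv'
  · by_contra h3
    have h2 : a₂.arr 3 v = 0 := by
      by_contra h; rw [x₃ v hi' h] at h3; exact h h3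
    have h1 : a₁.arr 3 v = 0 := by
      by_contra h; rw [x₂ v hi' h] at h2; exact h h2
    -- If all three trials fail, the coloring χ is the same throughout and avoids 1, 2 and 3 at this
    -- vertex.
    obtain ⟨rfl, c3⟩ := q₃.resolve_left (by simpa using h3)
    obtain ⟨rfl, c2⟩ := q₂.resolve_left (by simpa using h2)
    obtain ⟨rfl, c1⟩ := q₁.resolve_left (by simpa using h1)
    have := p₁.isCol.pos v hi'
    have := p₁.isCol.le v hi'
    omega

/-! ### Enumeration of the colorings of a set of vertices -/

/-- The number whose base `3` digits are the colors of the vertices of `D` in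
`{v, …, v + k - 1}`. -/
def encode (D χ : ℕ → ℕ) : ℕ → ℕ → ℕ
  | _, 0 => 0
  | v, k + 1 => if D v = 0 then encode D χ (v + 1) k else
      (χ v - 1) + 3 * encode D χ (v + 1) k

/-- The bound is the number of colorings of the set `D`, so an enumeration of that length meets the
code of every coloring. -/
theorem encode_lt {D χ : ℕ → ℕ} {n : ℕ} (hχ : ∀ v < n, χ v ≤ 3) (v k : ℕ) (hk : v + k ≤ n) :
    encode D χ v k < ∏ i ∈ Finset.range k, if D (v + i) = 0 then 1 else 3 := by
  induction k generalizing v with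
  | zero => simp [encode]
  | succ k ih =>
    have := ih (v + 1) (by omega)
    rw [Finset.prod_range_succ', encode]
    rw [Finset.prod_congr rfl fun i _ => by rw [show v + (i + 1) = v + 1 + i by omega], add_zero]
    have := hχ v (by omega)
    split_ifs <;> omega

/-- Divide variable `7` by `3`, with the quotient in variable `9` and the remainder in
variable `8`. -/
def divCmd : Cmd :=
  .seq (.assign 8 (.const 0)) <| .seq (.assign 9 (.const 0)) <| .loop true 10 <|
    .ite (.sub (.var 7) (.var 10))
      (.seq (.assign 8 (.add (.var 8) (.const 1))) <| .ite (.sub (.var 8) (.const 2))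
        (.seq (.assign 8 (.const 0)) (.assign 9 (.add (.var 9) (.const 1)))) .skip) .skip

theorem divCmd_spec {e : Env} (h : e.v 7 ≤ e.M) :
    e.v 7 = 3 * (divCmd.eval e).v 9 + (divCmd.eval e).v 8 ∧ (divCmd.eval e).v 8 < 3 := by
  have := loop_rule (m := true) (x := 10) (c := .ite (.sub (.var 7) (.var 10))
      (.seq (.assign 8 (.add (.var 8) (.const 1))) <| .ite (.sub (.var 8) (.const 2))
        (.seq (.assign 8 (.const 0)) (.assign 9 (.add (.var 9) (.const 1)))) .skip) .skip)
    (e := (e.setV 8 0).setV 9 0)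
    -- Division by counting: the first `e.v 7` rounds each add 1 to a base 3 counter, and the others
    -- do nothing.
    (fun i a => min i (e.v 7) = 3 * a.v 9 + a.v 8 ∧ a.v 8 < 3) (by simp) (by
      rintro i hi a hf ⟨h1, h2⟩
      have h7 : a.v 7 = e.v 7 := hf.v (by decide)
      by_cases c : 0 < e.v 7 - i
      · rw [Cmd.eval_ite_pos (by simpa [Expr.eval, h7] using c), Cmd.eval_seq]
        simp only [Cmd.eval_assign, Expr.eval, setV_v]
        norm_num
        by_cases c' : 2 ≤ a.v 8
        · rw [Cmd.eval_ite_pos (by simp [Expr.eval]; omega)]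
          simp [Cmd.eval_seq, Cmd.eval_assign, Expr.eval]
          omega
        · rw [Cmd.eval_ite_neg (by simp [Expr.eval]; omega)]
          simp [Cmd.eval_skip]
          omega
      · rw [Cmd.eval_ite_neg (by simpa [Expr.eval, h7] using c)]
        simp [Cmd.eval_skip]
        omega)
  simp only [bound_true, setV_M, min_eq_right h] at this
  exact this

/-- Color the vertices of the set in array `1` by the base `3` digits of variable `6`, and uncolor
the others. -/
def digitsCmd : Cmd :=
  .seq (.assign 7 (.var 6)) <| .loop false 11 <| .seq (.put 3 (.var 11) (.const 0)) <|
    .ite (.get 1 (.var 11)) (.seq divCmd <|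
      .seq (.put 3 (.var 11) (.add (.var 8) (.const 1))) (.assign 7 (.var 9))) .skip

theorem digitsCmd_spec {e : Env} {χ : ℕ → ℕ} (h1 : ∀ v < e.n, 1 ≤ χ v) (h3 : ∀ v < e.n, χ v ≤ 3)
    (hN : e.v 6 = encode (e.arr 1) χ 0 e.n) (hM : e.v 6 ≤ e.M) :
    ∀ v < e.n, (digitsCmd.eval e).arr 3 v = if e.arr 1 v = 0 then 0 else χ v := by
  have := loop_rule (m := false) (x := 11) (c := .seq (.put 3 (.var 11) (.const 0)) <|
    .ite (.get 1 (.var 11)) (.seq divCmd <|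
      .seq (.put 3 (.var 11) (.add (.var 8) (.const 1))) (.assign 7 (.var 9))) .skip)
    -- Variable 7 is the code of what remains from vertex `i` on; each vertex of the set strips off
    -- the last digit.
    (e := e.setV 7 (e.v 6)) (fun i a => a.v 7 = encode (e.arr 1) χ i (e.n - i) ∧ a.v 7 ≤ e.M ∧
      ∀ v < i, a.arr 3 v = if e.arr 1 v = 0 then 0 else χ v) (by simp [← hN, hM]) (by
    rintro i hi a hf ⟨ih, ihM, ihv⟩
    have hi' : i < e.n := hi
    have ha : a.arr 1 = e.arr 1 := hf.arr (by decide)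
    have haM : a.M = e.M := hf.M
    rw [show e.n - i = (e.n - (i + 1)) + 1 by omega, encode] at ih
    rw [Cmd.eval_seq]
    simp only [Cmd.eval_put, Expr.eval, setV_v, if_true]
    by_cases c : e.arr 1 i = 0
    · rw [Cmd.eval_ite_neg (by simp [Expr.eval, ha, c]), Cmd.eval_skip]
      rw [if_pos c] at ih
      refine ⟨by simpa using ih, by simpa using ihM, fun v hv => ?_⟩
      simp only [setA_arr, setV_arr, if_true, Function.update_apply]
      split_ifs with h h' h'
      · rfl
      · exact absurd (h ▸ c) h'
      · rw [ihv v (by omega), if_pos h']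
      · rw [ihv v (by omega), if_neg h']
    · rw [Cmd.eval_ite_pos (by simp [Expr.eval, ha]; omega), Cmd.eval_seq, Cmd.eval_seq]
      rw [if_neg c] at ih
      have hd := divCmd_spec (e := (a.setV 11 i).setA 3 i 0) (by simpa [haM] using ihM)
      have hfd := divCmd.frame ((a.setV 11 i).setA 3 i 0)
      generalize divCmd.eval ((a.setV 11 i).setA 3 i 0) = d at hd hfd ⊢
      have h11 : d.v 11 = i := (hfd.v (by decide)).trans (by simp)
      have ha3 : d.arr 3 = Function.update (a.arr 3) i 0 := (hfd.arr (by decide)).trans (by simp)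
      simp only [setA_v, setV_v] at hd
      norm_num at hd
      have := h1 i hi'
      have := h3 i hi'
      simp only [Cmd.eval_assign, Cmd.eval_put, Expr.eval, h11, setV_v, if_true, setA_v,
        setV_arr, setA_arr, ha3]
      refine ⟨by omega, by omega, fun v hv => ?_⟩
      simp only [Function.update_apply]
      split_ifs with h h' h'
      · exact absurd (h ▸ h') c
      · rw [h]; omega
      · rw [ihv v (by omega), if_pos h']
      · rw [ihv v (by omega), if_neg h'])
  exact this.2.2

/-- Extend the coloring with the number in variable `6`, and record it in case of success. -/
def extendCmd : Cmd :=
  .seq digitsCmd <| .seq completeCmd <| .seq checkCmd <| .seq checkRangeCmd <|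
    .ite (.var 3) .skip <| .seq (.assign 5 (.const 1)) <|
      .loop false 0 (.put 6 (.var 0) (.sub (.get 3 (.var 0)) (.const 1)))

/-- Variable `5` is a flag; if it is raised, then array `6` holds a proper coloring. -/
def Recorded (A : ℕ → ℕ → Prop) (n : ℕ) (e : Env) : Prop :=
  e.v 5 = 0 ∨ e.v 5 = 1 ∧ ∃ χ, IsCol A n χ ∧ ∀ v < n, e.arr 6 v = χ v - 1

/-- The result is verified before it is recorded, so soundness does not depend on the search.
Completeness concerns only a number that encodes some proper coloring on the dominating set. -/
theorem extendCmd_spec {A : ℕ → ℕ → Prop} (hA : ∀ u w, A u w → A w u) {e : Env} (h : Rep A e)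
    (hM : e.v 6 ≤ e.M) (hdom : Dominated A e.n (e.arr 1)) (hrec : Recorded A e.n e) :
    Recorded A e.n (extendCmd.eval e) ∧ (e.v 5 = 1 → (extendCmd.eval e).v 5 = 1) ∧
      ∀ χ, IsCol A e.n χ → e.v 6 = encode (e.arr 1) χ 0 e.n → (extendCmd.eval e).v 5 = 1 := by
  unfold extendCmd
  rw [Cmd.eval_seq, Cmd.eval_seq, Cmd.eval_seq, Cmd.eval_seq]
  have hfull : ∀ χ, IsCol A e.n χ → e.v 6 = encode (e.arr 1) χ 0 e.n →
      (checkRangeCmd.eval (checkCmd.eval (completeCmd.eval (digitsCmd.eval e)))).v 3 = 0 := by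
    intro χ hχ hN
    have hd := digitsCmd_spec hχ.pos hχ.le hN hM
    have hfd := digitsCmd.frame e
    have hrd : Rep A (digitsCmd.eval e) := h.eval _ (by decide) rfl
    generalize digitsCmd.eval e = e₁ at hd hfd hrd ⊢
    have hn₁ : e₁.n = e.n := hfd.n
    have hp : IsPart A e₁.n (e₁.arr 3) χ := by
      rw [hn₁]
      refine ⟨fun v hv => ?_, fun u hu => ?_, hχ, fun v hv h0 => ?_⟩
      · rw [hd v hv]
        have := hχ.le v hv
        split_ifs <;> omega
      · have key : ∀ w < e.n, e.arr 1 w ≠ 0 → e₁.arr 3 w ≠ 0 := fun w hw h0 => by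
          have := hχ.pos w hw
          rw [hd w hw, if_neg h0]; omega
        obtain h0 | ⟨w, hw, ha, h0⟩ := hdom u hu
        · exact .inl (key u hu h0)
        · exact .inr ⟨w, hw, ha, key w hw h0⟩
      · rw [hd v hv] at h0 ⊢
        split_ifs at h0 ⊢
        · exact absurd rfl h0
        · rfl
    obtain ⟨χ', hp', hc⟩ := completeCmd_spec hA hrd hp
    have hn₂ := (completeCmd.frame e₁).n
    have hr₂ : Rep A (completeCmd.eval e₁) := hrd.eval _ (by decide) rfl
    generalize completeCmd.eval e₁ = e₂ at hp' hc hn₂ hr₂ ⊢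
    have hf₃ := checkCmd.frame e₂
    have ha₃ : (checkCmd.eval e₂).arr 3 = e₂.arr 3 := hf₃.arr (by decide)
    rw [← hn₂] at hp' hc
    have heq : ∀ v < e₂.n, e₂.arr 3 v = χ' v := fun v hv => (hp'.ext v hv (hc v hv)).symm
    rw [checkRangeCmd_spec, checkCmd_spec hr₂, ha₃, hf₃.n]
    refine ⟨fun u hu w hw ha _ => ?_, fun u hu => ⟨?_, hp'.le u hu⟩⟩
    · rw [heq u hu, heq w hw]; exact hp'.isCol.proper u hu w hw ha
    · have := hc u hu; omega
  have hf₁ := digitsCmd.frame e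
  have hr₁ : Rep A (digitsCmd.eval e) := h.eval _ (by decide) rfl
  generalize digitsCmd.eval e = e₁ at hf₁ hr₁ hfull ⊢
  have hf₂ := completeCmd.frame e₁
  have hr₂ : Rep A (completeCmd.eval e₁) := hr₁.eval _ (by decide) rfl
  generalize completeCmd.eval e₁ = e₂ at hf₂ hr₂ hfull ⊢
  have hf₃ := checkCmd.frame e₂
  have hc₃ := checkCmd_spec hr₂
  generalize checkCmd.eval e₂ = e₃ at hf₃ hc₃ hfull ⊢
  have hf₄ := checkRangeCmd.frame e₃
  have hc₄ := checkRangeCmd_spec e₃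
  generalize checkRangeCmd.eval e₃ = e₄ at hf₄ hc₄ hfull ⊢
  have h5 : e₄.v 5 = e.v 5 := (hf₄.v (by decide)).trans <| (hf₃.v (by decide)).trans <|
    (hf₂.v (by decide)).trans (hf₁.v (by decide))
  have h6 : e₄.arr 6 = e.arr 6 := (hf₄.arr (by decide)).trans <| (hf₃.arr (by decide)).trans <|
    (hf₂.arr (by decide)).trans (hf₁.arr (by decide))
  have hn₂ : e₂.n = e.n := hf₂.n.trans hf₁.n
  have hn₃ : e₃.n = e.n := hf₃.n.trans hn₂
  have ha₃ : e₃.arr 3 = e₂.arr 3 := hf₃.arr (by decide)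
  have ha₄ : e₄.arr 3 = e₂.arr 3 := (hf₄.arr (by decide)).trans ha₃
  by_cases h0 : 0 < e₄.v 3
  · rw [Cmd.eval_ite_pos (by exact h0), Cmd.eval_skip]
    refine ⟨by simpa only [Recorded, h5, h6] using hrec, fun h => by rw [h5, h], fun χ hχ hN => ?_⟩
    have := hfull χ hχ hN
    omega
  · rw [Cmd.eval_ite_neg (by exact h0), Cmd.eval_seq]
    have hv : ((Cmd.loop false 0 (.put 6 (.var 0) (.sub (.get 3 (.var 0)) (.const 1)))).eval
        ((Cmd.assign 5 (.const 1)).eval e₄)).v 5 = 1 := by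
      rw [Cmd.eval_v _ _ (by decide)]
      simp [Cmd.eval_assign, Expr.eval]
    have hl := loop_rule (m := false) (x := 0)
      (c := .put 6 (.var 0) (.sub (.get 3 (.var 0)) (.const 1)))
      (e := (Cmd.assign 5 (.const 1)).eval e₄)
      (fun i a => ∀ v < i, a.arr 6 v = e₂.arr 3 v - 1) (by omega) (by
        intro i hi a hf ih v hv
        have ha : a.arr 3 = e₂.arr 3 := (hf.arr (by decide)).trans ha₄
        simp only [Cmd.eval_put, Expr.eval, setV_v, setV_arr, setA_arr, if_true, ha]
        obtain hv | rfl := Nat.lt_succ_iff_lt_or_eq.1 hv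
        · rw [Function.update_of_ne (by omega), ih v hv]
        · rw [Function.update_self])
    refine ⟨.inr ⟨hv, e₂.arr 3, ?_, fun v hv' => hl v ?_⟩, fun _ => hv, fun _ _ _ => hv⟩
    · obtain ⟨h30, h31⟩ := hc₄.1 (by omega)
      have := hc₃.1 h30
      rw [hn₂] at this
      rw [hn₃, ha₃] at h31
      exact ⟨fun v hv => (h31 v hv).1, fun v hv => (h31 v hv).2,
        fun u hu w hw ha => this u hu w hw ha (by have := (h31 u hu).1; omega)⟩
    · have : e₄.n = e.n := hf₄.n.trans hn₃
      simpa [Cmd.eval_assign, this] using hv'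

/-- Search for a coloring, given a dominating set in array `1`. -/
def searchCmd : Cmd :=
  .seq (.assign 5 (.const 0)) <| .seq (.loop true 6 extendCmd) <|
    .loop false 0 (.out (.var 0) (.get 6 (.var 0)))

theorem searchCmd_spec {A : ℕ → ℕ → Prop} (hA : ∀ u w, A u w → A w u) {e : Env} (h : Rep A e)
    (hM : e.M = ∏ i ∈ Finset.range e.n, if e.arr 1 i = 0 then 1 else 3)
    (hdom : Dominated A e.n (e.arr 1)) (hb : e.n ≤ e.b) :
    ((searchCmd.eval e).v 5 = 0 ∧ ¬ ∃ χ, IsCol A e.n χ) ∨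
    ((searchCmd.eval e).v 5 = 1 ∧ ∃ χ, IsCol A e.n χ ∧
      ∀ v < e.n, (searchCmd.eval e).inp v = χ v - 1) := by
  unfold searchCmd
  rw [Cmd.eval_seq, Cmd.eval_seq]
  set e₁ := (Cmd.assign 5 (.const 0)).eval e with he₁
  have hr₁ : Rep A e₁ := h
  have hl := loop_rule (m := true) (x := 6) (c := extendCmd) (e := e₁)
    (fun i a => Recorded A e.n a ∧ ∀ χ, IsCol A e.n χ → encode (e.arr 1) χ 0 e.n < i →
      a.v 5 = 1) ⟨.inl (by simp [he₁, Cmd.eval_assign, Expr.eval]), by omega⟩ (by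
      rintro i hi a hf ⟨ih, ih'⟩
      have ha : a.arr 1 = e.arr 1 := hf.arr (by decide)
      have hn : a.n = e.n := hf.n
      have haM : a.M = e.M := hf.M
      have hi' : i < e.M := hi
      have hr : Rep A (a.setV 6 i) := (hr₁.frame hf (by decide) rfl).setV 6 i
      obtain ⟨s1, s2, s3⟩ := extendCmd_spec hA hr (by simp [haM]; omega)
        (by simpa [hn, ha] using hdom) (by simpa [hn, Recorded] using ih)
      simp only [setV_n, hn, setV_v, setV_arr, ha] at s1 s2 s3
      refine ⟨s1, fun χ hχ hlt => ?_⟩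
      obtain hlt | heq := Nat.lt_succ_iff_lt_or_eq.1 hlt
      · exact s2 (ih' χ hχ hlt)
      · exact s3 χ hχ heq.symm)
  have hf := (Cmd.loop true 6 extendCmd).frame e₁
  generalize (Cmd.loop true 6 extendCmd).eval e₁ = e₂ at hl hf ⊢
  rw [Cmd.eval_v _ _ (by decide)]
  have hn₂ : e₂.n = e.n := hf.n
  have hb₂ : e₂.b = e.b := hf.b
  -- The output cells belong to the adjacency matrix, so they are overwritten only after the search.
  have ho := loop_rule (m := false) (x := 0) (c := .out (.var 0) (.get 6 (.var 0))) (e := e₂)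
    (fun i a => ∀ v < i, a.inp v = e₂.arr 6 v) (by omega) (by
      intro i hi a hf ih v hv
      have ha : a.arr 6 = e₂.arr 6 := hf.arr (by decide)
      have hb : i < a.b := by rw [hf.b, hb₂]; simp at hi; omega
      simp only [Cmd.eval_out, Expr.eval, setV_v, setV_arr, if_true, ha, Env.setI, setV_b, hb,
        setV_inp]
      obtain hv | rfl := Nat.lt_succ_iff_lt_or_eq.1 hv
      · rw [Function.update_of_ne (by omega), ih v hv]
      · rw [Function.update_self])
  obtain ⟨hrec, hall⟩ := hl
  have hlt : ∀ χ, IsCol A e.n χ → e₂.v 5 = 1 := fun χ hχ => hall χ hχ (by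
    have := encode_lt (D := e.arr 1) hχ.le 0 e.n (by omega)
    simp only [zero_add, ← hM] at this
    exact this)
  obtain h0 | ⟨h1, χ, hχ, h6⟩ := hrec
  · refine .inl ⟨h0, fun ⟨χ, hχ⟩ => ?_⟩
    have := hlt χ hχ
    omega
  · exact .inr ⟨h1, χ, hχ, fun v hv => by rw [ho v (by simpa [hn₂]), h6 v hv]⟩


/-! ### Small dominating sets -/

/-- The number of `i < n` with the property `P`. -/
noncomputable def count (n : ℕ) (P : ℕ → Prop) : ℕ :=
  open Classical in ((Finset.range n).filter P).card

/-! ### Counting, and the double counting inequality behind the greedy bound. -/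

section count

variable {n : ℕ} {P Q : ℕ → Prop}

theorem count_le (n : ℕ) (P : ℕ → Prop) : count n P ≤ n := by
  classical
  have := Finset.card_filter_le (Finset.range n) P
  simpa [count] using this

theorem count_zero (P : ℕ → Prop) : count 0 P = 0 := by simp [count]

theorem count_succ_pos (h : P n) : count (n + 1) P = count n P + 1 := by
  classical
  simp [count, Finset.range_add_one, Finset.filter_insert, h]

theorem count_succ_neg (h : ¬ P n) : count (n + 1) P = count n P := by
  classical
  simp [count, Finset.range_add_one, Finset.filter_insert, h]

theorem count_congr (h : ∀ i < n, P i ↔ Q i) : count n P = count n Q := by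
  classical
  unfold count
  congr 1
  exact Finset.filter_congr fun i hi => by simpa using h i (by simpa using hi)

theorem count_and_add_count_and_not (n : ℕ) (P Q : ℕ → Prop) :
    count n (fun i => P i ∧ Q i) + count n (fun i => P i ∧ ¬ Q i) = count n P := by
  classical
  have := Finset.card_filter_add_card_filter_not (s := (Finset.range n).filter P) Q
  simp only [Finset.filter_filter] at this
  unfold count
  convert this

theorem count_eq_zero (h : count n P = 0) : ∀ i < n, ¬ P i := by
  classical
  intro i hi hP
  simp only [count, Finset.card_eq_zero, Finset.filter_eq_empty_iff, Finset.mem_range] at h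
  exact h hi hP

theorem count_le_succ (w : ℕ) (h : ∀ i, P i → i = w ∨ Q i) : count n P ≤ count n Q + 1 := by
  classical
  unfold count
  refine le_trans (Finset.card_le_card ?_) (Finset.card_insert_le w ((Finset.range n).filter Q))
  intro i
  simp only [Finset.mem_filter, Finset.mem_insert]
  have := h i
  tauto

/-- Double counting. -/
theorem mul_count_le {A : ℕ → ℕ → Prop} (hA : ∀ u w, A u w → A w u) {δ m : ℕ}
    (hδ : ∀ u < n, δ ≤ count n (A u)) (hm : ∀ v < n, count n (fun u => P u ∧ A v u) ≤ m) :
    δ * count n P ≤ n * m := by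
  classical
  have := Finset.card_mul_le_card_mul A (s := (Finset.range n).filter P) (t := Finset.range n)
    (m := δ) (n := m) (fun u hu => ?_) (fun v hv => ?_)
  · simpa [count, mul_comm] using this
  · refine (hδ u (by simp at hu; exact hu.1)).trans (le_of_eq ?_)
    simp only [count, Finset.bipartiteAbove]
  · refine (le_of_eq ?_).trans (hm v (by simpa using hv))
    unfold count
    congr 1
    ext u
    simp only [Finset.bipartiteBelow, Finset.mem_filter, and_assoc]
    exact and_congr_right fun _ => and_congr_right fun _ => ⟨hA _ _, hA _ _⟩

end count

/-- Count in variable `15` how often the test succeeds. -/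
def countCmd (t : Expr) : Cmd :=
  .seq (.assign 15 (.const 0)) <|
    .loop false 0 (.ite t (.assign 15 (.add (.var 15) (.const 1))) .skip)

theorem countCmd_spec {t : Expr} {e : Env} (P : ℕ → Prop)
    (h : ∀ i < e.n, ∀ a, Frame (countCmd (.const 0)) e a → (0 < t.eval (a.setV 0 i) ↔ P i)) :
    ((countCmd t).eval e).v 15 = count e.n P := by
  refine loop_rule (m := false) (e := e.setV 15 0) (fun i a => a.v 15 = count i P)
    (by simp [count_zero]) ?_
  intro i hi a hf ih
  -- The test affects neither the variables nor the arrays that may change, so the frame is stated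
  -- with a fixed test.
  have hf' : Frame (countCmd (.const 0)) e a := by
    refine ⟨hf.n, hf.M, hf.b, fun {y} hy => ?_, hf.arr, hf.inp⟩
    have h1 : y ≠ 15 := by rintro rfl; exact hy (by decide)
    have h2 : y ≠ 0 := by rintro rfl; exact hy (by decide)
    rw [hf.v (by simp [Cmd.vars, h1, h2]), setV_v, if_neg h1]
  have ht := h i hi a hf'
  by_cases c : P i
  · rw [Cmd.eval_ite_pos (ht.2 c), count_succ_pos c]
    simpa [Cmd.eval_assign, Expr.eval] using ih
  · rw [Cmd.eval_ite_neg (mt ht.1 c), count_succ_neg c]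
    simpa [Cmd.eval_skip] using ih

/-- The first expression is positive and the second one is zero. -/
def andNotE (a b : Expr) : Expr := .sub (.sub (.const 1) (.sub (.const 1) a)) b

theorem andNotE_pos {e : Env} (a b : Expr) :
    0 < (andNotE a b).eval e ↔ b.eval e = 0 ∧ 0 < a.eval e := by
  simp only [andNotE, Expr.eval]; omega

/-- Find a vertex with the maximum number of neighbors that are not marked in array `2`. -/
def bestCmd : Cmd :=
  .seq (.assign 13 (.const 0)) <| .loop false 16 <|
    .seq (countCmd (andNotE (adjE (.var 16) (.var 0)) (.get 2 (.var 0)))) <|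
    .ite (.sub (.var 15) (.var 13)) (.seq (.assign 13 (.var 15)) (.assign 14 (.var 16))) .skip

theorem bestCmd_spec {A : ℕ → ℕ → Prop} {e : Env} (h : Rep A e) :
    (∀ v < e.n, count e.n (fun u => e.arr 2 u = 0 ∧ A v u) ≤ (bestCmd.eval e).v 13) ∧
    ((bestCmd.eval e).v 13 = 0 ∨ (bestCmd.eval e).v 14 < e.n ∧ (bestCmd.eval e).v 13 =
      count e.n (fun u => e.arr 2 u = 0 ∧ A ((bestCmd.eval e).v 14) u)) := by
  refine loop_rule (m := false) (e := e.setV 13 0) (fun i a =>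
    (∀ v < i, count e.n (fun u => e.arr 2 u = 0 ∧ A v u) ≤ a.v 13) ∧
    (a.v 13 = 0 ∨ a.v 14 < e.n ∧ a.v 13 = count e.n (fun u => e.arr 2 u = 0 ∧ A (a.v 14) u)))
    ⟨by omega, by simp⟩ ?_
  rintro i hi a hf ⟨ih, ih'⟩
  have hi' : i < e.n := hi
  have hn : a.n = e.n := hf.n
  have hr : Rep A (a.setV 16 i) := ((h.setV 13 0).frame hf (by decide) rfl).setV 16 i
  have hc := countCmd_spec (e := a.setV 16 i)
    (t := andNotE (adjE (.var 16) (.var 0)) (.get 2 (.var 0)))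
    (fun u => e.arr 2 u = 0 ∧ A i u) (by
      intro u hu a' hf'
      have h16 : a'.v 16 = i := (hf'.v (by decide)).trans (by simp)
      have ha : a'.arr 2 = e.arr 2 := (hf'.arr (by decide)).trans (hf.arr (by decide))
      have hn' : a'.n = e.n := hf'.n.trans hn
      have hr' : Rep A (a'.setV 0 u) := (hr.frame hf' (by decide) rfl).setV 0 u
      have ht := adjE_pos hr' (x := 16) (y := 0) (by simpa [hn', h16]) (by
        simp only [setV_n, hn] at hu; simpa [hn'])
      simp only [setV_v, h16] at ht
      norm_num at ht
      rw [andNotE_pos, ht]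
      simp [Expr.eval, ha])
  rw [Cmd.eval_seq]
  have hfc := (countCmd (andNotE (adjE (.var 16) (.var 0)) (.get 2 (.var 0)))).frame (a.setV 16 i)
  generalize (countCmd (andNotE (adjE (.var 16) (.var 0)) (.get 2 (.var 0)))).eval
    (a.setV 16 i) = d at hc hfc ⊢
  simp only [setV_n, hn] at hc
  have h13 : d.v 13 = a.v 13 := (hfc.v (by decide)).trans (by simp)
  have h14 : d.v 14 = a.v 14 := (hfc.v (by decide)).trans (by simp)
  have h16 : d.v 16 = i := (hfc.v (by decide)).trans (by simp)
  by_cases c : 0 < d.v 15 - d.v 13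
  · rw [Cmd.eval_ite_pos (by exact c)]
    simp only [Cmd.eval_seq, Cmd.eval_assign, Expr.eval, setV_v, h16]
    norm_num
    refine ⟨fun v hv => ?_, .inr ⟨hi', hc⟩⟩
    obtain hv | rfl := Nat.lt_or_eq_of_le hv
    · have := ih v hv; omega
    · exact hc.ge
  · rw [Cmd.eval_ite_neg (by exact c), Cmd.eval_skip, h13, h14]
    refine ⟨fun v hv => ?_, ih'⟩
    obtain hv | rfl := Nat.lt_succ_iff_lt_or_eq.1 hv
    · exact ih v hv
    · omega

/-- Mark the neighbors of the vertex in variable `14` in array `2`. -/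
def markCmd : Cmd :=
  .loop false 0 (.ite (adjE (.var 14) (.var 0)) (.put 2 (.var 0) (.const 1)) .skip)

theorem markCmd_spec {A : ℕ → ℕ → Prop} {e : Env} (h : Rep A e) (hv : e.v 14 < e.n) :
    ∀ u < e.n, (markCmd.eval e).arr 2 u = 0 ↔ e.arr 2 u = 0 ∧ ¬ A (e.v 14) u := by
  have := loop_rule (m := false) (x := 0) (c := .ite (adjE (.var 14) (.var 0))
    (.put 2 (.var 0) (.const 1)) .skip) (e := e)
    (fun i a => ∀ u, (a.arr 2 u = 0 ↔ e.arr 2 u = 0 ∧ (u < i → ¬ A (e.v 14) u))) (by simp) (by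
      intro i hi a hf ih u
      have h14 : a.v 14 = e.v 14 := hf.v (by decide)
      have hr : Rep A (a.setV 0 i) := (h.frame hf (by decide) rfl).setV 0 i
      have hn : a.n = e.n := hf.n
      have hi' : i < e.n := hi
      have ht := adjE_pos hr (x := 14) (y := 0) (by simpa [hn, h14] using hv) (by simpa [hn])
      simp only [setV_v, h14] at ht
      norm_num at ht
      by_cases c : A (e.v 14) i
      · rw [Cmd.eval_ite_pos (ht.2 c)]
        simp only [Cmd.eval_put, Expr.eval, setV_v, if_true, setA_arr, setV_arr,
          Function.update_apply]
        split_ifs with hu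
        · simp [hu, c]
        · rw [ih u, Nat.lt_succ_iff_lt_or_eq]
          simp [hu]
      · rw [Cmd.eval_ite_neg (mt ht.1 c), Cmd.eval_skip, setV_arr, ih u, Nat.lt_succ_iff_lt_or_eq]
        refine and_congr_right fun _ => ⟨?_, fun hx hu => hx (.inl hu)⟩
        rintro hx (hu | rfl)
        exacts [hx hu, c])
  intro u hu
  have := this u
  simp only [bound_false, hu, true_implies] at this
  exact this

/-- One round of the greedy algorithm: array `1` is the set, array `2` marks the vertices with a
neighbor in the set, and variable `17` is the size of the set. -/
def greedyRoundCmd : Cmd :=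
  .seq bestCmd <| .ite (.var 13) (.seq (.put 1 (.var 14) (.const 1)) <|
    .seq (.assign 17 (.add (.var 17) (.const 1))) markCmd) .skip

/-- The vertices that are marked in array `2` have neighbors in the set in array `1`, whose size is
at most the value of variable `17`. -/
structure Marked (A : ℕ → ℕ → Prop) (n : ℕ) (e : Env) : Prop where
  nbr : ∀ u < n, e.arr 2 u ≠ 0 → ∃ w < n, A u w ∧ e.arr 1 w ≠ 0
  size : count n (fun w => e.arr 1 w ≠ 0) ≤ e.v 17

/-- Let U be the number of unmarked vertices. Double counting gives a vertex with at least δU/n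
unmarked neighbors, which is the last inequality, cleared of denominators. The third inequality says
that a vertex added to the set marks at least one new vertex. -/
theorem greedyRoundCmd_spec {A : ℕ → ℕ → Prop} (hA : ∀ u w, A u w → A w u) {e : Env}
    (h : Rep A e) (hm : Marked A e.n e) {δ : ℕ} (hδ : ∀ u < e.n, δ ≤ count e.n (A u)) :
    Marked A e.n (greedyRoundCmd.eval e) ∧
    (greedyRoundCmd.eval e).v 17 ≤ e.v 17 + 1 ∧
    (greedyRoundCmd.eval e).v 17 + count e.n (fun u => (greedyRoundCmd.eval e).arr 2 u = 0) ≤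
      e.v 17 + count e.n (fun u => e.arr 2 u = 0) ∧
    e.n * count e.n (fun u => (greedyRoundCmd.eval e).arr 2 u = 0) +
      δ * count e.n (fun u => e.arr 2 u = 0) ≤ e.n * count e.n (fun u => e.arr 2 u = 0) := by
  unfold greedyRoundCmd
  rw [Cmd.eval_seq]
  obtain ⟨hb, hb'⟩ := bestCmd_spec h
  have hf := bestCmd.frame e
  have hr : Rep A (bestCmd.eval e) := h.eval _ (by decide) rfl
  generalize bestCmd.eval e = d at hb hb' hf hr ⊢
  have hdc := mul_count_le hA hδ hb
  have h17 : d.v 17 = e.v 17 := hf.v (by decide)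
  have ha1 : d.arr 1 = e.arr 1 := hf.arr (by decide)
  have ha2 : d.arr 2 = e.arr 2 := hf.arr (by decide)
  have hn : d.n = e.n := hf.n
  by_cases c : 0 < d.v 13
  · obtain ⟨h14, h13⟩ := hb'.resolve_left (by omega)
    rw [Cmd.eval_ite_pos (by exact c), Cmd.eval_seq, Cmd.eval_seq]
    set d₁ := (Cmd.assign 17 (.add (.var 17) (.const 1))).eval
      ((Cmd.put 1 (.var 14) (.const 1)).eval d) with hd₁
    have hr₁ : Rep A d₁ := hr
    have hmk := markCmd_spec hr₁ (by simpa [hd₁, Cmd.eval_assign, Cmd.eval_put, hn] using h14)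
    have e17 : (markCmd.eval d₁).v 17 = e.v 17 + 1 := by
      rw [Cmd.eval_v _ _ (by decide)]
      simp [hd₁, Cmd.eval_assign, Cmd.eval_put, Expr.eval, h17]
    have e1 : (markCmd.eval d₁).arr 1 = Function.update (e.arr 1) (d.v 14) 1 := by
      rw [Cmd.eval_arr _ _ (by decide)]
      simp [hd₁, Cmd.eval_assign, Cmd.eval_put, Expr.eval, ha1]
    have f2 : d₁.arr 2 = e.arr 2 := by
      simp [hd₁, Cmd.eval_assign, Cmd.eval_put, ha2]
    have f14 : d₁.v 14 = d.v 14 := by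
      simp [hd₁, Cmd.eval_assign, Cmd.eval_put]
    have fn : d₁.n = e.n := by simp [hd₁, Cmd.eval_assign, Cmd.eval_put, hn]
    rw [f2, f14, fn] at hmk
    generalize markCmd.eval d₁ = d₂ at hmk e17 e1 ⊢
    have hU : count e.n (fun u => d₂.arr 2 u = 0) + d.v 13 =
        count e.n (fun u => e.arr 2 u = 0) := by
      rw [count_congr hmk, h13, add_comm]
      exact count_and_add_count_and_not _ _ _
    refine ⟨⟨fun u hu h0 => ?_, ?_⟩, by omega, by omega, ?_⟩
    · rw [e1]
      by_cases hud : e.arr 2 u = 0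
      · have : A (d.v 14) u := by
          by_contra hna
          exact h0 ((hmk u hu).2 ⟨hud, hna⟩)
        exact ⟨_, h14, hA _ _ this, by simp⟩
      · obtain ⟨w, hw, ha, hw0⟩ := hm.nbr u hu hud
        refine ⟨w, hw, ha, ?_⟩
        rw [Function.update_apply]; split_ifs
        exacts [by omega, hw0]
    · rw [e1, e17]
      refine (count_le_succ (d.v 14) fun w hw => ?_).trans (Nat.add_le_add_right hm.size 1)
      rw [Function.update_apply] at hw
      split_ifs at hw with hwv
      exacts [.inl hwv, .inr hw]
    · have := Nat.mul_add e.n (count e.n fun u => d₂.arr 2 u = 0) (d.v 13)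
      rw [hU] at this
      omega
  · rw [Cmd.eval_ite_neg (by exact c), Cmd.eval_skip, ha2, h17]
    have : d.v 13 = 0 := by omega
    rw [this] at hdc
    refine ⟨⟨?_, ?_⟩, by omega, le_rfl, by omega⟩
    · rw [ha1, ha2]; exact hm.nbr
    · rw [ha1, h17]; exact hm.size

/-- The greedy algorithm. -/
def greedyCmd : Cmd := .loop false 12 greedyRoundCmd

/-- The size of the set plus the number of unmarked vertices never grows, so its value after `k`
rounds bounds the final size. The bound is stated for all `k`, since the best choice is a matter of
analysis and not of the program. Marks come from neighbors only, so even the members of the set have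
neighbors in it. -/
theorem greedyCmd_spec {A : ℕ → ℕ → Prop} (hA : ∀ u w, A u w → A w u) {e : Env}
    (h : Rep A e) (h1 : e.arr 1 = fun _ => 0) (h2 : e.arr 2 = fun _ => 0) (h17 : e.v 17 = 0)
    {δ : ℕ} (hδ : ∀ u < e.n, δ ≤ count e.n (A u)) (hpos : 0 < δ) (hn : 0 < e.n) :
    Dominated A e.n ((greedyCmd.eval e).arr 1) ∧
    count e.n (fun w => (greedyCmd.eval e).arr 1 w ≠ 0) ≤ (greedyCmd.eval e).v 17 ∧
    ∀ k : ℕ, ((greedyCmd.eval e).v 17 : ℝ) ≤ k + e.n * (1 - δ / e.n : ℝ) ^ k := by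
  have hδn : δ ≤ e.n := (hδ 0 hn).trans (count_le _ _)
  have hn' : (0 : ℝ) < e.n := by exact_mod_cast hn
  have hq : (0 : ℝ) ≤ 1 - δ / e.n := by
    rw [sub_nonneg, div_le_one hn']; exact_mod_cast hδn
  obtain ⟨hm, hs, hU, hU', hk⟩ := loop_rule (m := false) (x := 12) (c := greedyRoundCmd) (e := e)
    (fun i a => Marked A e.n a ∧ a.v 17 ≤ i ∧
      -- While unmarked vertices remain, each round marks one because δ is positive; so n rounds
      -- mark them all.
      (count e.n (fun u => a.arr 2 u = 0) = 0 ∨ count e.n (fun u => a.arr 2 u = 0) + i ≤ e.n) ∧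
      (count e.n (fun u => a.arr 2 u = 0) : ℝ) ≤ e.n * (1 - δ / e.n : ℝ) ^ i ∧
      ∀ k ≤ i, (a.v 17 + count e.n (fun u => a.arr 2 u = 0) : ℝ) ≤
        k + e.n * (1 - δ / e.n : ℝ) ^ k) (by
      have := count_le e.n (fun u => e.arr 2 u = 0)
      have h' : (count e.n (fun u => e.arr 2 u = 0) : ℝ) ≤ e.n := by exact_mod_cast this
      refine ⟨⟨fun u _ hu => by simp [h2] at hu, ?_⟩, h17.le, .inr this, by simpa using h', ?_⟩
      · simp [h1, count]
      · intro k hk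
        obtain rfl : k = 0 := by omega
        simpa [h17] using h') (by
      rintro i hi a hf ⟨hm, hs, hU, hU', hk⟩
      have hna : a.n = e.n := hf.n
      have hr : Rep A (a.setV 12 i) := (h.frame hf (by decide) rfl).setV 12 i
      obtain ⟨m, s1, s2, s3⟩ := greedyRoundCmd_spec hA hr (δ := δ)
        (by simpa [hna] using ⟨hm.nbr, by simpa using hm.size⟩) (by simpa [hna] using hδ)
      simp only [setV_n, hna, setV_v, setV_arr] at m s1 s2 s3
      norm_num at s1 s2
      generalize greedyRoundCmd.eval (a.setV 12 i) = a' at m s1 s2 s3 ⊢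
      generalize count e.n (fun u => a.arr 2 u = 0) = U at *
      generalize count e.n (fun u => a'.arr 2 u = 0) = U' at *
      have hUU : (U' : ℝ) ≤ U * (1 - δ / e.n : ℝ) := by
        have : (e.n * U' + δ * U : ℝ) ≤ e.n * U := by exact_mod_cast s3
        have h3 : (U * (1 - δ / e.n) : ℝ) = (e.n * U - δ * U) / e.n := by field_simp
        rw [h3, le_div_iff₀ hn']
        linarith
      have hV : (U' : ℝ) ≤ e.n * (1 - δ / e.n : ℝ) ^ (i + 1) := by
        rw [pow_succ, ← mul_assoc]
        exact hUU.trans (mul_le_mul_of_nonneg_right hU' hq)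
      refine ⟨m, by omega, ?_, hV, fun k hk' => ?_⟩
      · obtain rfl | hU0 := Nat.eq_zero_or_pos U
        · left
          have : e.n * U' = 0 := by omega
          exact (Nat.mul_eq_zero.1 this).resolve_left (by omega)
        · have : U' < U := by
            have h4 : 0 < δ * U := Nat.mul_pos hpos hU0
            exact Nat.lt_of_mul_lt_mul_left (a := e.n) (by omega)
          omega
      · obtain hk' | rfl := Nat.le_succ_iff.1 hk'
        · refine le_trans ?_ (hk k hk')
          exact_mod_cast s2
        · have : (a'.v 17 : ℝ) ≤ ((i + 1 : ℕ) : ℝ) := by exact_mod_cast (by omega)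
          rw [Nat.succ_eq_add_one]
          linarith)
  change Marked A e.n (greedyCmd.eval e) at hm
  change count e.n (fun u => (greedyCmd.eval e).arr 2 u = 0) = 0 ∨
    count e.n (fun u => (greedyCmd.eval e).arr 2 u = 0) + e.n ≤ e.n at hU
  change (greedyCmd.eval e).v 17 ≤ e.n at hs
  have h0 : count e.n (fun u => (greedyCmd.eval e).arr 2 u = 0) = 0 := by omega
  refine ⟨fun u hu => .inr (hm.nbr u hu (count_eq_zero h0 u hu)), hm.size, fun k => ?_⟩
  by_cases hk' : k ≤ e.n
  · refine le_trans ?_ (hk k hk')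
    change ((greedyCmd.eval e).v 17 : ℝ) ≤ (greedyCmd.eval e).v 17 + _
    simp
  -- For `k` beyond n, the size is at most the number n of rounds.
  · have h5 : ((greedyCmd.eval e).v 17 : ℝ) ≤ k := by exact_mod_cast (by omega)
    have := mul_nonneg hn'.le (pow_nonneg hq k)
    linarith

/-! ### Neighborhoods as dominating sets, and the number of colorings to enumerate. -/

/-- Store the neighborhood of the vertex in variable `16` in array `1`. -/
def nbrCmd : Cmd :=
  .loop false 0 (.ite (adjE (.var 16) (.var 0)) (.put 1 (.var 0) (.const 1))
    (.put 1 (.var 0) (.const 0)))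

theorem nbrCmd_spec {A : ℕ → ℕ → Prop} {e : Env} (h : Rep A e) (hv : e.v 16 < e.n) :
    ∀ u < e.n, (nbrCmd.eval e).arr 1 u ≠ 0 ↔ A (e.v 16) u := by
  refine loop_rule (m := false) (fun i a => ∀ u < i, a.arr 1 u ≠ 0 ↔ A (e.v 16) u) (by omega) ?_
  intro i hi a hf ih u hu
  have h16 : a.v 16 = e.v 16 := hf.v (by decide)
  have hr : Rep A (a.setV 0 i) := (h.frame hf (by decide) rfl).setV 0 i
  have hn : a.n = e.n := hf.n
  have hi' : i < e.n := hi
  have ht := adjE_pos hr (x := 16) (y := 0) (by simpa [hn, h16] using hv) (by simpa [hn])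
  simp only [setV_v, h16] at ht
  norm_num at ht
  by_cases c : A (e.v 16) i
  · rw [Cmd.eval_ite_pos (ht.2 c)]
    simp only [Cmd.eval_put, Expr.eval, setV_v, if_true, setA_arr, setV_arr, Function.update_apply]
    split_ifs with hui
    · simp [hui, c]
    · exact ih u (by omega)
  · rw [Cmd.eval_ite_neg (mt ht.1 c)]
    simp only [Cmd.eval_put, Expr.eval, setV_v, if_true, setA_arr, setV_arr, Function.update_apply]
    split_ifs with hui
    · simp [hui, c]
    · exact ih u (by omega)

/-- Replace the set in array `1` by smaller neighborhoods of vertices. -/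
def improveCmd : Cmd :=
  .loop false 16 <| .seq (countCmd (adjE (.var 16) (.var 0))) <|
    .ite (.sub (.var 17) (.var 15)) (.seq (.assign 17 (.var 15)) nbrCmd) .skip

/-- Variable 17 bounds the size of the current set and only decreases. The outcome is at most the
greedy bound and at most every degree. -/
theorem improveCmd_spec {A : ℕ → ℕ → Prop} {e : Env} (h : Rep A e)
    (hN : ∀ v < e.n, ∀ D : ℕ → ℕ, (∀ u < e.n, D u ≠ 0 ↔ A v u) → Dominated A e.n D)
    (hdom : Dominated A e.n (e.arr 1)) (hs : count e.n (fun w => e.arr 1 w ≠ 0) ≤ e.v 17) :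
    Dominated A e.n ((improveCmd.eval e).arr 1) ∧
    count e.n (fun w => (improveCmd.eval e).arr 1 w ≠ 0) ≤ e.v 17 ∧
    ∀ v < e.n, count e.n (fun w => (improveCmd.eval e).arr 1 w ≠ 0) ≤ count e.n (A v) := by
  obtain ⟨h1, h2, h3, h4⟩ := loop_rule (m := false) (x := 16)
    (c := .seq (countCmd (adjE (.var 16) (.var 0))) <|
    .ite (.sub (.var 17) (.var 15)) (.seq (.assign 17 (.var 15)) nbrCmd) .skip) (e := e)
    (fun i a => Dominated A e.n (a.arr 1) ∧ count e.n (fun w => a.arr 1 w ≠ 0) ≤ a.v 17 ∧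
      a.v 17 ≤ e.v 17 ∧ ∀ v < i, a.v 17 ≤ count e.n (A v)) ⟨hdom, hs, le_rfl, by omega⟩ (by
    rintro i hi a hf ⟨ih1, ih2, ih3, ih4⟩
    have hi' : i < e.n := hi
    have hn : a.n = e.n := hf.n
    have hr : Rep A (a.setV 16 i) := (h.frame hf (by decide) rfl).setV 16 i
    have hc := countCmd_spec (e := a.setV 16 i) (t := adjE (.var 16) (.var 0)) (A i) (by
        intro u hu a' hf'
        have h16 : a'.v 16 = i := (hf'.v (by decide)).trans (by simp)
        have hn' : a'.n = e.n := hf'.n.trans hn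
        have hr' : Rep A (a'.setV 0 u) := (hr.frame hf' (by decide) rfl).setV 0 u
        have ht := adjE_pos hr' (x := 16) (y := 0) (by simpa [hn', h16]) (by
          simp only [setV_n, hn] at hu; simpa [hn'])
        simp only [setV_v, h16] at ht
        norm_num at ht
        exact ht)
    rw [Cmd.eval_seq]
    have hfc := (countCmd (adjE (.var 16) (.var 0))).frame (a.setV 16 i)
    have hrc : Rep A ((countCmd (adjE (.var 16) (.var 0))).eval (a.setV 16 i)) :=
      hr.eval _ (by decide) rfl
    generalize (countCmd (adjE (.var 16) (.var 0))).eval (a.setV 16 i) = d at hc hfc hrc ⊢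
    simp only [setV_n, hn] at hc
    have h17 : d.v 17 = a.v 17 := (hfc.v (by decide)).trans (by simp)
    have h16 : d.v 16 = i := (hfc.v (by decide)).trans (by simp)
    have ha1 : d.arr 1 = a.arr 1 := hfc.arr (by decide)
    have hnd : d.n = e.n := hfc.n.trans hn
    by_cases c : 0 < d.v 17 - d.v 15
    · rw [Cmd.eval_ite_pos (by exact c), Cmd.eval_seq]
      have hnb := nbrCmd_spec (e := (Cmd.assign 17 (.var 15)).eval d) (hrc.setV _ _)
        (by simpa [Cmd.eval_assign, h16, hnd] using hi')
      have hv17 : (nbrCmd.eval ((Cmd.assign 17 (.var 15)).eval d)).v 17 = count e.n (A i) := by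
        rw [Cmd.eval_v _ _ (by decide), Cmd.eval_assign]
        simpa [Expr.eval] using hc
      have e16 : ((Cmd.assign 17 (.var 15)).eval d).v 16 = i := by simp [Cmd.eval_assign, h16]
      have en : ((Cmd.assign 17 (.var 15)).eval d).n = e.n := by simp [Cmd.eval_assign, hnd]
      rw [e16, en] at hnb
      generalize nbrCmd.eval ((Cmd.assign 17 (.var 15)).eval d) = d' at hnb hv17 ⊢
      refine ⟨hN i hi' _ hnb, ?_, by omega, fun v hv => ?_⟩
      · rw [hv17, count_congr hnb]
      · obtain hv | rfl := Nat.lt_succ_iff_lt_or_eq.1 hv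
        · have := ih4 v hv; omega
        · exact hv17.le
    · rw [Cmd.eval_ite_neg (by exact c), Cmd.eval_skip, ha1, h17]
      refine ⟨ih1, ih2, ih3, fun v hv => ?_⟩
      obtain hv | rfl := Nat.lt_succ_iff_lt_or_eq.1 hv
      · exact ih4 v hv
      · omega)
  exact ⟨h1, h2.trans h3, fun v hv => h2.trans (h4 v hv)⟩

/-- Compute the number of colorings of the set in array `1`. -/
def powCmd : Cmd :=
  .seq (.assign 18 (.const 1)) <| .loop false 0 <|
    .ite (.get 1 (.var 0)) (.assign 18 (.add (.var 18) (.add (.var 18) (.var 18)))) .skip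

theorem powCmd_spec (e : Env) :
    (powCmd.eval e).v 18 = ∏ i ∈ Finset.range e.n, if e.arr 1 i = 0 then 1 else 3 := by
  refine loop_rule (m := false) (e := e.setV 18 1)
    (fun i a => a.v 18 = ∏ i ∈ Finset.range i, if e.arr 1 i = 0 then 1 else 3) (by simp) ?_
  intro i hi a hf ih
  have ha : a.arr 1 = e.arr 1 := hf.arr (by decide)
  rw [Finset.prod_range_succ, ← ih]
  by_cases c : e.arr 1 i = 0
  · rw [Cmd.eval_ite_neg (by simp [Expr.eval, ha, c])]
    simp [Cmd.eval_skip, c]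
  · rw [Cmd.eval_ite_pos (by simp [Expr.eval, ha]; omega)]
    simp [Cmd.eval_assign, Expr.eval, c]
    omega

theorem prod_eq_pow_count (D : ℕ → ℕ) (n : ℕ) :
    (∏ i ∈ Finset.range n, if D i = 0 then 1 else 3) = 3 ^ count n (fun i => D i ≠ 0) := by
  induction n with
  | zero => simp [count_zero]
  | succ n ih =>
    rw [Finset.prod_range_succ, ih]
    by_cases c : D n = 0
    · rw [if_pos c, count_succ_neg (by simpa using c), mul_one]
    · rw [if_neg c, count_succ_pos c, pow_succ]

/-- Compute the offsets of the rows of the adjacency matrix, and the square of `n` in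
variable `12`. -/
def rowsCmd : Cmd :=
  .seq (.assign 12 (.const 0)) <| .loop false 0 <|
    .seq (.put 0 (.var 0) (.var 12)) (.assign 12 (.add (.var 12) .size))

theorem rowsCmd_spec (e : Env) : ∀ u < e.n, (rowsCmd.eval e).arr 0 u = e.n * u := by
  refine (loop_rule (m := false) (e := e.setV 12 0)
    (fun i a => a.v 12 = e.n * i ∧ ∀ u < i, a.arr 0 u = e.n * u) (by simp) ?_).2
  rintro i hi a hf ⟨ih, ih'⟩
  have hn : a.n = e.n := hf.n
  simp only [Cmd.eval_seq, Cmd.eval_put, Cmd.eval_assign, Expr.eval, setV_v, setA_v, setV_arr,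
    setA_arr, setA_n, setV_n, if_true, hn]
  norm_num
  refine ⟨by rw [ih]; ring, fun u hu => ?_⟩
  obtain hu | rfl := Nat.lt_or_eq_of_le hu
  · rw [Function.update_of_ne (by omega), ih' u hu]
  · rw [Function.update_self, ih]

/-- Compute the square of `n` in variable `12`. -/
def squareCmd : Cmd :=
  .seq (.assign 12 (.const 0)) <| .loop false 0 (.assign 12 (.add (.var 12) .size))

theorem squareCmd_spec (e : Env) : (squareCmd.eval e).v 12 = e.n * e.n := by
  refine loop_rule (m := false) (e := e.setV 12 0) (fun i a => a.v 12 = e.n * i) (by simp) ?_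
  intro i hi a hf ih
  have hn : a.n = e.n := hf.n
  simp [Cmd.eval_assign, Expr.eval, ih, hn, Nat.mul_succ]

/-- Compute a small dominating set and the number of its colorings. -/
def dominateCmd : Cmd := .seq rowsCmd <| .seq greedyCmd <| .seq improveCmd powCmd

theorem dominateCmd_spec {A : ℕ → ℕ → Prop} (hA : ∀ u w, A u w → A w u) {e : Env}
    (h : ∀ u < e.n, ∀ w < e.n, 0 < e.inp (e.n * u + w) ↔ A u w)
    (harr : ∀ k, e.arr k = fun _ => 0) (h17 : e.v 17 = 0)
    (hN : ∀ v < e.n, ∀ D : ℕ → ℕ, (∀ u < e.n, D u ≠ 0 ↔ A v u) → Dominated A e.n D)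
    (hpos : ∀ v < e.n, 0 < count e.n (A v)) (hn : 0 < e.n) :
    Rep A (dominateCmd.eval e) ∧ Dominated A e.n ((dominateCmd.eval e).arr 1) ∧
    ∃ m δ : ℕ, (dominateCmd.eval e).v 18 = 3 ^ m ∧ m ≤ δ ∧ δ ≤ e.n ∧
      (dominateCmd.eval e).v 18 =
        (∏ i ∈ Finset.range e.n, if (dominateCmd.eval e).arr 1 i = 0 then 1 else 3) ∧
      ∀ k : ℕ, (m : ℝ) ≤ k + e.n * (1 - δ / e.n : ℝ) ^ k := by
  unfold dominateCmd
  rw [Cmd.eval_seq, Cmd.eval_seq, Cmd.eval_seq]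
  have hrow := rowsCmd_spec e
  have hf₁ := rowsCmd.frame e
  generalize rowsCmd.eval e = e₁ at hrow hf₁ ⊢
  have hr₁ : Rep A e₁ := by
    intro u hu w hw
    rw [hf₁.n] at hu hw
    rw [hrow u hu, hf₁.inp rfl]
    exact h u hu w hw
  -- The minimum degree serves both as the δ of the greedy bound and as the bound from the
  -- improvement by neighborhoods.
  obtain ⟨v₀, hv₀, hmin⟩ := Finset.exists_min_image (Finset.range e.n) (fun v => count e.n (A v))
    ⟨0, by simpa using hn⟩
  simp only [Finset.mem_range] at hv₀ hmin
  have hg := greedyCmd_spec hA hr₁ ((hf₁.arr (by decide)).trans (harr 1))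
    ((hf₁.arr (by decide)).trans (harr 2)) ((hf₁.v (by decide)).trans h17)
    (δ := count e.n (A v₀)) (by rw [hf₁.n]; exact hmin) (hpos v₀ hv₀) (by rw [hf₁.n]; exact hn)
  have hf₂ := greedyCmd.frame e₁
  have hr₂ : Rep A (greedyCmd.eval e₁) := hr₁.eval _ (by decide) rfl
  rw [hf₁.n] at hg
  generalize greedyCmd.eval e₁ = e₂ at hg hf₂ hr₂ ⊢
  have hn₂ : e₂.n = e.n := hf₂.n.trans hf₁.n
  obtain ⟨g1, g2, g3⟩ := hg
  obtain ⟨i1, i2, i3⟩ := improveCmd_spec hr₂ (by rwa [hn₂]) (by rwa [hn₂]) (by rwa [hn₂])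
  have hf₃ := improveCmd.frame e₂
  have hr₃ : Rep A (improveCmd.eval e₂) := hr₂.eval _ (by decide) rfl
  rw [hn₂] at i1 i2 i3
  generalize improveCmd.eval e₂ = e₃ at i1 i2 i3 hf₃ hr₃ ⊢
  have hn₃ : e₃.n = e.n := hf₃.n.trans hn₂
  have hpow := powCmd_spec e₃
  have hf₄ := powCmd.frame e₃
  have hr₄ : Rep A (powCmd.eval e₃) := hr₃.eval _ (by decide) rfl
  have ha₄ : (powCmd.eval e₃).arr 1 = e₃.arr 1 := hf₄.arr (by decide)
  rw [hn₃] at hpow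
  refine ⟨hr₄, by rwa [ha₄], _, _, by rw [hpow, prod_eq_pow_count], i3 v₀ hv₀, count_le _ _,
    by rw [ha₄, hpow], fun k => ?_⟩
  refine le_trans ?_ (g3 k)
  exact_mod_cast i2


/-! ### The size of the search space -/

theorem one_le_sqrt_mul_logb {n : ℕ} (hn : 2 ≤ n) : 1 ≤ √((n : ℝ) * Real.logb 2 n) := by
  have h2 : (2 : ℝ) ≤ n := by exact_mod_cast hn
  have hl : 1 ≤ Real.logb 2 n := by
    rw [Real.le_logb_iff_rpow_le (by norm_num) (by linarith)]
    simpa using h2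
  rw [Real.one_le_sqrt]
  nlinarith

/-- With s = √(n log₂ n), the case δ ≤ s follows from m ≤ δ. Otherwise take k = ⌈n ln n / δ⌉. Then k
≤ s + 1, because n ln n ≤ s² ≤ sδ, and n(1 - δ/n)^k ≤ n exp(-δk/n) ≤ 1. -/
theorem le_sqrt_of_forall_le {n m δ : ℕ} (hn : 2 ≤ n) (hm : m ≤ δ) (hδ : δ ≤ n)
    (h : ∀ k : ℕ, (m : ℝ) ≤ k + n * (1 - δ / n : ℝ) ^ k) :
    (m : ℝ) ≤ √((n : ℝ) * Real.logb 2 n) + 2 := by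
  have h2 : (2 : ℝ) ≤ n := by exact_mod_cast hn
  have hn0 : (0 : ℝ) < n := by linarith
  have hs1 := one_le_sqrt_mul_logb hn
  set s := √((n : ℝ) * Real.logb 2 n) with hs
  have hlog : 0 ≤ Real.log n := Real.log_nonneg (by linarith)
  have hlogb : Real.log n ≤ Real.logb 2 n := by
    rw [Real.logb, le_div_iff₀ (Real.log_pos (by norm_num))]
    have : Real.log 2 ≤ 1 := by have := Real.log_two_lt_d9; linarith
    nlinarith
  have hss : s * s = n * Real.logb 2 n :=
    Real.mul_self_sqrt (mul_nonneg hn0.le (hlog.trans hlogb))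
  have hmδ : (m : ℝ) ≤ δ := by exact_mod_cast hm
  by_cases hle : (δ : ℝ) ≤ s
  · linarith
  push Not at hle
  have hδ0 : (0 : ℝ) < δ := by linarith
  refine (h ⌈n * Real.log n / δ⌉₊).trans ?_
  have hk : (⌈n * Real.log n / δ⌉₊ : ℝ) ≤ s + 1 := by
    refine (Nat.ceil_lt_add_one (by positivity)).le.trans ?_
    have : n * Real.log n / δ ≤ s := by
      rw [div_le_iff₀ hδ0]
      nlinarith
    linarith
  have hk' := Nat.le_ceil (n * Real.log n / δ)
  generalize ⌈n * Real.log n / δ⌉₊ = k at hk hk'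
  have hpow : (1 - δ / n : ℝ) ^ k ≤ 1 / n := by
    have h1 : (0 : ℝ) ≤ 1 - δ / n := by
      rw [sub_nonneg, div_le_one hn0]; exact_mod_cast hδ
    calc (1 - δ / n : ℝ) ^ k ≤ Real.exp (-(δ / n)) ^ k :=
          pow_le_pow_left₀ h1 (Real.one_sub_le_exp_neg _) k
      _ = Real.exp (-(δ * k / n)) := by rw [← Real.exp_nat_mul]; congr 1; ring
      _ ≤ Real.exp (-Real.log n) := by
          rw [Real.exp_le_exp, neg_le_neg_iff, le_div_iff₀ hn0]
          rw [div_le_iff₀ hδ0] at hk'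
          linarith
      _ = 1 / n := by rw [Real.exp_neg, Real.exp_log hn0, one_div]
  have : n * (1 - δ / n : ℝ) ^ k ≤ 1 := by
    calc n * (1 - δ / n : ℝ) ^ k ≤ n * (1 / n) := mul_le_mul_of_nonneg_left hpow hn0.le
      _ = 1 := by field_simp
  linarith

/-- Additive constants are absorbed by s = √(n log₂ n) ≥ 1. In particular 3^m ≤ 2^(2m) ≤ 2^(2s + 4)
≤ 2^(6s), and the sum of the three terms costs at most another factor 4 ≤ 2^(2s). -/
theorem time_le_two_rpow {n m K k : ℕ} (hn : 2 ≤ n)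
    (hm : (m : ℝ) ≤ √((n : ℝ) * Real.logb 2 n) + 2) :
    ((K * (n + 3 ^ m + 1) ^ k : ℕ) : ℝ) ≤
      2 ^ (((K + 8 * k : ℕ) : ℝ) * √((n : ℝ) * Real.logb 2 n)) := by
  have h2 : (2 : ℝ) ≤ n := by exact_mod_cast hn
  have hn0 : (0 : ℝ) < n := by linarith
  have hs1 := one_le_sqrt_mul_logb hn
  have hns : Real.logb 2 n ≤ √((n : ℝ) * Real.logb 2 n) := by
    have h0 : 0 ≤ Real.logb 2 n := Real.logb_nonneg (by norm_num) (by linarith)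
    refine Real.le_sqrt_of_sq_le ?_
    rw [sq]
    refine mul_le_mul_of_nonneg_right ?_ h0
    rw [Real.logb_le_iff_le_rpow (by norm_num) hn0, Real.rpow_natCast]
    exact_mod_cast Nat.lt_two_pow_self.le
  generalize √((n : ℝ) * Real.logb 2 n) = s at hm hs1 hns
  have one_le : (1 : ℝ) ≤ 2 := by norm_num
  have b1 : (n : ℝ) ≤ 2 ^ (6 * s) := by
    rw [← Real.logb_le_iff_le_rpow (by norm_num) hn0]
    linarith
  have b2 : (3 : ℝ) ^ m ≤ 2 ^ (6 * s) := by
    calc (3 : ℝ) ^ m ≤ 4 ^ m := pow_le_pow_left₀ (by norm_num) (by norm_num) m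
      _ = 2 ^ ((2 * m : ℕ) : ℝ) := by rw [Real.rpow_natCast, pow_mul]; norm_num
      _ ≤ 2 ^ (6 * s) := by
          refine Real.rpow_le_rpow_of_exponent_le one_le ?_
          push_cast; linarith
  have b3 : (1 : ℝ) ≤ 2 ^ (6 * s) := Real.one_le_rpow one_le (by linarith)
  have b4 : ((n + 3 ^ m + 1 : ℕ) : ℝ) ≤ 2 ^ (8 * s) := by
    have h4 : (4 : ℝ) ≤ 2 ^ (2 * s) := by
      calc (4 : ℝ) = 2 ^ (2 : ℝ) := by norm_num
        _ ≤ 2 ^ (2 * s) := Real.rpow_le_rpow_of_exponent_le one_le (by linarith)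
    have h8 : (2 : ℝ) ^ (8 * s) = 2 ^ (2 * s) * 2 ^ (6 * s) := by
      rw [← Real.rpow_add (by norm_num)]; ring_nf
    rw [h8]
    push_cast
    nlinarith
  have b5 : (K : ℝ) ≤ 2 ^ (K * s) := by
    calc (K : ℝ) ≤ 2 ^ K := by exact_mod_cast Nat.lt_two_pow_self.le
      _ = 2 ^ (K : ℝ) := (Real.rpow_natCast _ _).symm
      _ ≤ 2 ^ (K * s) := by
          refine Real.rpow_le_rpow_of_exponent_le one_le ?_
          have : (0 : ℝ) ≤ K := Nat.cast_nonneg K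
          nlinarith
  calc ((K * (n + 3 ^ m + 1) ^ k : ℕ) : ℝ) = K * ((n + 3 ^ m + 1 : ℕ) : ℝ) ^ k := by push_cast; rfl
    _ ≤ 2 ^ (K * s) * (2 ^ (8 * s)) ^ k := by gcongr
    _ = 2 ^ (((K + 8 * k : ℕ) : ℝ) * s) := by
        rw [← Real.rpow_natCast, ← Real.rpow_mul (by norm_num), ← Real.rpow_add (by norm_num)]
        congr 1; push_cast; ring

/-! ### Graphs of diameter two -/

/-- The adjacency relation of a graph on `Fin n` as a relation on `ℕ`. -/
def natAdj {n : ℕ} (G : SimpleGraph (Fin n)) (u w : ℕ) : Prop :=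
  ∃ (hu : u < n) (hw : w < n), G.Adj ⟨u, hu⟩ ⟨w, hw⟩

theorem natAdj_symm {n : ℕ} (G : SimpleGraph (Fin n)) (u w : ℕ) (h : natAdj G u w) :
    natAdj G w u := by
  obtain ⟨hu, hw, h⟩ := h
  exact ⟨hw, hu, h.symm⟩

theorem adj_or_exists_adj_of_diam {V : Type*} {G : SimpleGraph V} (h : G.diam = 2) {u v : V}
    (huv : u ≠ v) : G.Adj u v ∨ ∃ w, G.Adj u w ∧ G.Adj w v := by
  -- `diam` is 0 when the extended diameter is infinite, so the value 2 also gives connectedness.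
  have htop : G.ediam ≠ ⊤ := SimpleGraph.ediam_ne_top_of_diam_ne_zero (by omega)
  have hd : G.dist u v ≤ 2 := h ▸ SimpleGraph.dist_le_diam htop
  obtain ⟨p, hp⟩ :=
    (SimpleGraph.preconnected_of_ediam_ne_top htop u v).exists_walk_length_eq_dist
  rw [← hp] at hd
  match p with
  | .nil => exact absurd rfl huv
  | .cons h1 .nil => exact .inl h1
  | .cons h1 (.cons h2 .nil) => exact .inr ⟨_, h1, h2⟩
  | .cons _ (.cons _ (.cons _ _)) => simp at hd

theorem two_le_of_diam {n : ℕ} {G : SimpleGraph (Fin n)} (h : G.diam = 2) : 2 ≤ n := by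
  have := SimpleGraph.nontrivial_of_diam_ne_zero (G := G) (by omega)
  exact Fin.nontrivial_iff_two_le.1 this

theorem exists_natAdj {n : ℕ} {G : SimpleGraph (Fin n)} (h : G.diam = 2) {v : ℕ} (hv : v < n) :
    ∃ w < n, natAdj G v w := by
  have := SimpleGraph.nontrivial_of_diam_ne_zero (G := G) (by omega)
  obtain ⟨u, hu⟩ := exists_ne (⟨v, hv⟩ : Fin n)
  obtain ha | ⟨w, ha, -⟩ := adj_or_exists_adj_of_diam h hu.symm
  exacts [⟨u, u.2, hv, u.2, ha⟩, ⟨w, w.2, hv, w.2, ha⟩]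

/-- A vertex other than `v` is adjacent to `v` or shares a neighbor with it. The vertex `v` is not
in its own neighborhood and needs a neighbor there, which exists because the graph is nontrivial. -/
theorem dominated_of_diam {n : ℕ} {G : SimpleGraph (Fin n)} (h : G.diam = 2) {v : ℕ} (hv : v < n)
    {D : ℕ → ℕ} (hD : ∀ u < n, D u ≠ 0 ↔ natAdj G v u) : Dominated (natAdj G) n D := by
  intro u hu
  by_cases huv : u = v
  · subst huv
    obtain ⟨w, hw, ha⟩ := exists_natAdj h hu
    exact .inr ⟨w, hw, ha, (hD w hw).2 ha⟩
  · obtain ha | ⟨w, ha, ha'⟩ := adj_or_exists_adj_of_diam h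
      (u := (⟨u, hu⟩ : Fin n)) (v := ⟨v, hv⟩) (by simpa using huv)
    · exact .inl ((hD u hu).2 ⟨hv, hu, ha.symm⟩)
    · exact .inr ⟨w, w.2, ⟨hu, w.2, ha⟩, (hD w w.2).2 ⟨hv, w.2, ha'.symm⟩⟩

theorem IsCol.exists_coloring {n : ℕ} {G : SimpleGraph (Fin n)} {χ : ℕ → ℕ}
    (h : IsCol (natAdj G) n χ) : ∃ c : G.Coloring (Fin 3), ∀ v : Fin n, χ v - 1 = c v := by
  have h1 := h.pos
  have h3 := h.le
  refine ⟨SimpleGraph.Coloring.mk (fun v => ⟨χ v - 1, by have := h3 v v.2; omega⟩) ?_,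
    fun v => rfl⟩
  intro u w ha heq
  simp only [Fin.mk.injEq] at heq
  have := h.proper u u.2 w w.2 ⟨u.2, w.2, ha⟩
  have := h1 u u.2
  have := h1 w w.2
  omega

theorem exists_isCol_of_colorable {n : ℕ} {G : SimpleGraph (Fin n)} (h : G.Colorable 3) :
    ∃ χ, IsCol (natAdj G) n χ := by
  obtain ⟨c⟩ := h
  refine ⟨fun v => if hv : v < n then (c ⟨v, hv⟩ : ℕ) + 1 else 0, ?_, ?_, ?_⟩
  · intro v hv; simp [hv]
  · intro v hv
    have := (c ⟨v, hv⟩).2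
    simp only [hv, dif_pos]; omega
  · rintro u hu w hw ⟨_, _, ha⟩
    have := c.valid ha
    simpa [hu, hw, Fin.val_inj] using this

/-! ### The algorithm -/

/-- The program that decides `3`-colorability. -/
def coloringProg : Prog :=
  .seq (squareCmd.compile 0) <| .seq (copyProg 1 (vreg 12)) <| .seq (dominateCmd.compile 0) <|
    .seq (copyProg 2 (vreg 18)) <| .seq (searchCmd.compile 0) (copyProg 0 (vreg 5))

theorem input_mem_pos {n : ℕ} (G : SimpleGraph (Fin n)) {u w : ℕ} (hu : u < n) (hw : w < n) :
    0 < (input G).mem (n * u + w) ↔ natAdj G u w := by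
  have : (∃ u' w' : Fin n, n * u + w = n * u' + w' ∧ G.Adj u' w') ↔ natAdj G u w := by
    constructor
    · rintro ⟨u', w', he, ha⟩
      have hn : 0 < n := by omega
      have h1 : u = u' := by
        have := congrArg (· / n) he
        simpa [Nat.mul_add_div hn, Nat.div_eq_of_lt hw, Nat.div_eq_of_lt w'.2] using this
      have h2 : w = w' := by
        have := congrArg (· % n) he
        simpa [Nat.mul_add_mod, Nat.mod_eq_of_lt hw, Nat.mod_eq_of_lt w'.2] using this
      have e1 : (⟨u, hu⟩ : Fin n) = u' := Fin.ext h1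
      have e2 : (⟨w, hw⟩ : Fin n) = w' := Fin.ext h2
      exact ⟨hu, hw, by rwa [e1, e2]⟩
    · rintro ⟨hu, hw, ha⟩
      exact ⟨_, _, rfl, ha⟩
  rw [← this]
  simp only [input]
  split_ifs with h <;> simp [h]

theorem input_mem_of_le {n : ℕ} (G : SimpleGraph (Fin n)) {a : ℕ} (ha : n * n ≤ a) :
    (input G).mem a = 0 := by
  simp only [input]
  rw [if_neg]
  rintro ⟨u, w, rfl, -⟩
  have : n * (u + 1) ≤ n * n := Nat.mul_le_mul_left n u.2
  have := w.2
  rw [Nat.mul_add] at *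
  omega

theorem coloringProg_spec {n : ℕ} (G : SimpleGraph (Fin n)) (h : G.diam = 2) :
    ∃ (s : State) (m δ : ℕ), m ≤ δ ∧ δ ≤ n ∧
      (∀ k : ℕ, (m : ℝ) ≤ k + n * (1 - δ / n : ℝ) ^ k) ∧ AnswersThreeColoring G s ∧
      Within coloringProg (input G) s (squareCmd.time n 0 + (2 + (dominateCmd.time n 0 +
        (2 + (searchCmd.time n (3 ^ m) + 2))))) := by
  have hn2 := two_le_of_diam h
  -- the base address of the arrays
  obtain ⟨s₁, w₁, -, d₁⟩ := squareCmd.compile_spec 0 (input G)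
  have r0 : s₁.reg 0 = n := by
    have := congrArg Env.n d₁; rw [Cmd.eval_n] at this; exact this
  have r1 : s₁.reg 1 = 0 := by
    have := congrArg Env.b d₁; rw [Cmd.eval_b] at this; exact this
  have r2 : s₁.reg 2 = 0 := by
    have := congrArg Env.M d₁; rw [Cmd.eval_M] at this; exact this
  have r12 : s₁.reg (vreg 12) = n * n := by
    have := congrFun (congrArg Env.v d₁) 12; rw [squareCmd_spec] at this; exact this
  have r17 : s₁.reg (vreg 17) = 0 := by
    have := congrFun (congrArg Env.v d₁) 17; rw [Cmd.eval_v _ _ (by decide)] at this; exact this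
  -- With base address 0 the eight interleaved arrays cover the whole memory; `squareCmd` changes no
  -- array, so it leaves the input untouched.
  have hmem : s₁.mem = (input G).mem := by
    funext a
    have := congrArg (fun e : Env => e.arr ⟨a % 8, Nat.mod_lt _ (by norm_num)⟩ (a / 8)) d₁
    simp only [Cmd.eval_arr squareCmd _ (a := ⟨a % 8, Nat.mod_lt _ (by norm_num)⟩)
      (by simp [squareCmd, Cmd.arrs])] at this
    have ha : 8 * (a / 8) + a % 8 = a := Nat.div_add_mod a 8
    have r1' : (input G).reg 1 = 0 := rfl
    simpa [decode, r1, r1', ha] using this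
  -- Base address n² puts the arrays right after the matrix, where the memory is initially zero.
  have w₂ := within_copy (i := 1) (j := vreg 12) (by decide) s₁
  rw [r12] at w₂
  set s₂ := s₁.setReg 1 (n * n) with hs₂
  have q0 : s₂.reg 0 = n := by simpa [hs₂, State.setReg] using r0
  have q1 : s₂.reg 1 = n * n := by simp [hs₂]
  have q2 : s₂.reg 2 = 0 := by simpa [hs₂, State.setReg] using r2
  have q17 : s₂.reg (vreg 17) = 0 :=
    (Function.update_of_ne (show vreg 17 ≠ 1 by decide) (n * n) s₁.reg).trans r17
  have hmem₂ : s₂.mem = (input G).mem := hmem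
  -- the dominating set
  obtain ⟨s₃, w₃, -, d₃⟩ := dominateCmd.compile_spec 0 s₂
  have hspec := dominateCmd_spec (natAdj_symm G) (e := decode s₂) (by
      intro u hu w hw
      replace hu : u < n := q0 ▸ hu
      replace hw : w < n := q0 ▸ hw
      have hlt : n * u + w < n * n := by
        have : n * (u + 1) ≤ n * n := Nat.mul_le_mul_left n hu
        rw [Nat.mul_add] at this
        omega
      rw [← input_mem_pos G hu hw]
      simp [decode, q0, q1, hmem₂, hlt]) (by
      intro k; funext i
      simp only [decode, q1, hmem₂]
      exact input_mem_of_le G (by omega)) q17 (by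
      intro v hv D hD
      simp only [decode, q0] at hv hD ⊢
      exact dominated_of_diam h hv hD) (by
      intro v hv
      simp only [decode, q0] at hv ⊢
      obtain ⟨w, hw, ha⟩ := exists_natAdj h hv
      by_contra h0
      exact count_eq_zero (by omega) w hw ha) (by simp only [decode, q0]; omega)
  have hn₃ := dominateCmd.eval_n (decode s₂)
  have hb₃ := dominateCmd.eval_b (decode s₂)
  rw [← d₃] at hspec hn₃ hb₃
  replace hn₃ : s₃.reg 0 = n := hn₃.trans q0
  replace hb₃ : s₃.reg 1 = n * n := hb₃.trans q1
  have hnd : (decode s₂).n = n := q0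
  rw [hnd] at hspec
  obtain ⟨hrep, hdom, m, δ, h18, hmδ, hδ, hprod, hk⟩ := hspec
  have w₄ := within_copy (i := 2) (j := vreg 18) (by decide) s₃
  replace h18 : s₃.reg (vreg 18) = 3 ^ m := h18
  replace hprod : s₃.reg (vreg 18) = _ := hprod
  -- Register 2 is read by `decode` only as the loop bound M, which now becomes the number of
  -- colorings.
  have hd₄ : decode (s₃.setReg 2 (s₃.reg (vreg 18))) =
      { decode s₃ with M := s₃.reg (vreg 18) } := by
    have hv : ∀ x, vreg x ≠ 2 := by intro x; simp only [vreg]; omega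
    simp [decode, State.setReg, hv]
  have p0 : (s₃.setReg 2 (s₃.reg (vreg 18))).reg 0 = n := by simpa [State.setReg] using hn₃
  have p1 : (s₃.setReg 2 (s₃.reg (vreg 18))).reg 1 = n * n := by simpa [State.setReg] using hb₃
  have p2 : (s₃.setReg 2 (s₃.reg (vreg 18))).reg 2 = 3 ^ m := by simp [h18]
  generalize s₃.setReg 2 (s₃.reg (vreg 18)) = s₄ at w₄ hd₄ p0 p1 p2
  -- the search
  obtain ⟨s₅, w₅, -, d₅⟩ := searchCmd.compile_spec 0 s₄
  have hspec := searchCmd_spec (natAdj_symm G) (e := decode s₄) (by rw [hd₄]; exact hrep)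
    (by rw [hd₄]; simp only; rw [show (decode s₃).n = n from hn₃]; exact hprod)
    (by rw [hd₄]; simp only; rw [show (decode s₃).n = n from hn₃]; exact hdom)
    (by simp only [decode, p0, p1]; nlinarith)
  have hb₅ := searchCmd.eval_b (decode s₄)
  rw [← d₅] at hspec hb₅
  replace hb₅ : s₅.reg 1 = n * n := hb₅.trans p1
  rw [show (decode s₄).n = n from p0] at hspec
  have w₆ := within_copy (i := 0) (j := vreg 5) (by decide) s₅
  refine ⟨s₅.setReg 0 (s₅.reg (vreg 5)), m, δ, hmδ, hδ, hk, ?_, w₁.seq (w₂.seq ?_)⟩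
  · obtain ⟨h0, hno⟩ | ⟨h1, χ, hχ, hinp⟩ := hspec
    · replace h0 : s₅.reg (vreg 5) = 0 := h0
      exact ⟨fun hc => (hno (exists_isCol_of_colorable hc)).elim, fun _ => by simp [h0]⟩
    · replace h1 : s₅.reg (vreg 5) = 1 := h1
      obtain ⟨c, hc⟩ := hχ.exists_coloring
      refine ⟨fun _ => ⟨by simp [h1], c, fun v => ?_⟩, fun hno => (hno ⟨c⟩).elim⟩
      rw [← hc v, ← hinp v v.2]
      -- The output cells lie below the base address, so `decode` shows their true contents.
      have : (v : ℕ) < n * n := by have := v.2; nlinarith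
      simp [decode, hb₅, this, State.setReg]
  · rw [q0, q2] at w₃
    rw [p0, p2] at w₅
    exact w₃.seq (w₄.seq (w₅.seq w₆))

end RAM

theorem mainTheorem10 :
    ∃ (P : RAM.Prog) (e : ℕ → ℝ),
      e =O[atTop] (fun n : ℕ => Real.sqrt ((n : ℝ) * Real.logb 2 (n : ℝ))) ∧
      ∀ (n : ℕ) (G : SimpleGraph (Fin n)), IrreducibleGraph G → G.diam = 2 →
        ∃ (s : RAM.State) (t : ℕ), RAM.Exec P (RAM.input G) s t ∧
          RAM.AnswersThreeColoring G s ∧ (t : ℝ) ≤ (2 : ℝ) ^ e n := by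
  obtain ⟨K₁, k₁, h₁⟩ := RAM.squareCmd.time_le
  obtain ⟨K₂, k₂, h₂⟩ := RAM.dominateCmd.time_le
  obtain ⟨K₃, k₃, h₃⟩ := RAM.searchCmd.time_le
  -- The 6 pays for the three register copies between and after the phases, at two steps each.
  refine ⟨RAM.coloringProg, fun n => ((K₁ + K₂ + K₃ + 6 + 8 * (k₁ + k₂ + k₃) : ℕ) : ℝ) *
    √((n : ℝ) * Real.logb 2 n), isBigO_const_mul_self _ _ _, fun n G _ hG => ?_⟩
  obtain ⟨s, m, δ, hm, hδ, hk, hs, t, ht, hexec⟩ := RAM.coloringProg_spec G hG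
  have hn := RAM.two_le_of_diam hG
  refine ⟨s, t, hexec, hs, le_trans ?_
    (RAM.time_le_two_rpow hn (RAM.le_sqrt_of_forall_le hn hm hδ hk))⟩
  refine Nat.cast_le.2 (ht.trans ?_)
  have key : ∀ (K k M : ℕ), M ≤ 3 ^ m → k ≤ k₁ + k₂ + k₃ →
      K * (n + M + 1) ^ k ≤ K * (n + 3 ^ m + 1) ^ (k₁ + k₂ + k₃) := fun K k M hM hk =>
    Nat.mul_le_mul_left K <| (Nat.pow_le_pow_left (by omega) k).trans
      (Nat.pow_le_pow_right (by omega) hk)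
  -- The first two phases run with M = 0, as register 2 is set only before the search.
  have b₁ := (h₁ n 0).trans (key K₁ k₁ 0 (Nat.zero_le _) (by omega))
  have b₂ := (h₂ n 0).trans (key K₂ k₂ 0 (Nat.zero_le _) (by omega))
  have b₃ := (h₃ n (3 ^ m)).trans (key K₃ k₃ (3 ^ m) le_rfl (by omega))
  have b₄ : 1 ≤ (n + 3 ^ m + 1) ^ (k₁ + k₂ + k₃) := Nat.one_le_pow _ _ (Nat.succ_pos _)
  simp only [Nat.add_mul]
  omega
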